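/- **Reduction Lemma II.** *Setting.* Let $C$ be one of the split composition rings over $\mathbb Z$: the quaternions $\mathbb H_{\mathbb Z}=M_2(\mathbb Z)$, with norm $n=\det$, trace $t$ the matrix trace, and conjugation $\overline{\begin{pmatrix}a&b\\c&d\end{pmatrix}}=\begin{pmatrix}d&-b\\-c&a\end{pmatrix}$; the binarions $\mathbb B_{\mathbb Z}\subset\mathbb H_{\mathbb Z}$, the diagonal matrices; or the octonions $\mathbb O_{\mathbb Z}=\mathbb H_{\mathbb Z}\oplus\mathbb H_{\mathbb Z}v$, with $(a+bv)(c+dv)=(ac-\bar d b)+(da+b\bar c)v$, $n(a+bv)=\det a+\det b$, $t(a+bv)=t(a)$, $\overline{a+bv}=\bar a-bv$. Let $J_{\mathbb Z}=H_3(C)$ be the $\mathbb Z$-module of Hermitian matrices $$A=\begin{pmatrix}a&z&\bar y\\ \bar z&b&x\\ y&\bar x&c\end{pmatrix},\qquad a,b,c\in\mathbb Z,\ x,y,z\in C,$$ with the cubic norm $N(A)=abc-a\,n(x)-b\,n(y)-c\,n(z)+t((xy)z)$, the trace bilinear form $(A,B)=\operatorname{tr}\bigl(\tfrac12(AB+BA)\bigr)$,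 the adjoint map $A\mapsto A^\#$, determined by the identity $(A^\#,B)=\frac{d}{ds}\big|_{s=0}N(A+sB)$ for all $B$, and $A\times B=(A+B)^\#-A^\#-B^\#$. Let $M(J_{\mathbb Z})=\mathbb Z\oplus\mathbb Z\oplus J_{\mathbb Z}\oplus J_{\mathbb Z}$, with elements $x=(\alpha,\beta,A,B)$, the skew-symmetric form $\{(\alpha,\beta,A,B),(\gamma,\delta,C,D)\}=\alpha\delta-\beta\gamma+(A,D)-(B,C)$, and the quartic forms $$q'(x)=-4(A^\#,B^\#)+4\alpha N(A)+4\beta N(B)+\bigl((A,B)-\alpha\beta\bigr)^2,\qquad q=-2q'.$$ Let $G_{\mathbb Z}$ be the group of invertible $\mathbb Z$-linear transformations of $M(J_{\mathbb Z})$ preserving $q$ and $\{\cdot,\cdot\}$. An element $(\alpha,\beta,(a_1,a_2,a_3),(b_1,b_2,b_3))$ of $M(\mathbb Z\oplus\mathbb Z\oplus\mathbb Z)=\mathbb Z\oplus\mathbb Z\oplus\mathbb Z^3\oplus\mathbb Z^3$ is *projective* if each of the three binary quadratic forms $$(\alpha a_i-b_jb_k)X^2+(-a_ib_i+a_jb_j+a_kb_k-\alpha\beta)XY+(\beta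 b_i-a_ja_k)Y^2,\qquad \{i,j,k\}=\{1,2,3\},$$ is primitive (its coefficients have greatest common divisor $1$). An element $x\in M(J_{\mathbb Z})$ is *projective* if its $G_{\mathbb Z}$-orbit contains an element $(\alpha,\beta,\operatorname{diag}(a_1,a_2,a_3),0)$ with $\alpha>0$, $\alpha\mid\beta$, $\alpha\mid a_i$ for $i=1,2,3$, such that $(\alpha,\beta,(a_1,a_2,a_3),(0,0,0))$ is projective in $M(\mathbb Z\oplus\mathbb Z\oplus\mathbb Z)$. The elementary transformations considered are $$\begin{aligned}\phi(C)&:(\alpha,\beta,A,B)\mapsto(\alpha+(B,C)+(A,C^\#)+\beta N(C),\ \beta,\ A+\beta C,\ B+A\times C+\beta C^\#),\\ \psi(D)&:(\alpha,\beta,A,B)\mapsto(\alpha,\ \beta+(A,D)+(B,D^\#)+\alpha N(D),\ A+B\times D+\alpha D^\#,\ B+\alpha D),\\ T(s)&:(\alpha,\beta,A,B)\mapsto(\alpha,\ \beta,\ s(A),\ s^{*-1}(B)),\\ \tau&:(\alpha,\beta,A,B)\mapsto(-\beta,\ \alpha,\ -B,\ A),\end{aligned}$$ where $C,D\in J_{\mathbb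 Z}$, $s$ is an invertible $\mathbb Z$-linear transformation of $J_{\mathbb Z}$ with $N(s(A))=N(A)$ for all $A$, and $s^*$ is its adjoint with respect to $(\cdot,\cdot)$. *Statement.* Let $J_{\mathbb Z}$ be one of $H_3(\mathbb B_{\mathbb Z})$, $H_3(\mathbb H_{\mathbb Z})$, $H_3(\mathbb O_{\mathbb Z})$, and let $x\in M(J_{\mathbb Z})$ be projective. Then a finite series of the above elementary transformations carries $x$ to an element $$(1,\ \varepsilon,\ \operatorname{diag}(1,1,k),\ 0),\qquad \varepsilon\in\{0,1\},\ k\in\mathbb Z.$$ The values of $\varepsilon$ and $k$ are uniquely determined by $q'(x)$: whenever $x$ is carried to such an element, $q'(x)=4k+\varepsilon^2$, and this equation has exactly one solution with $\varepsilon\in\{0,1\}$ and $k\in\mathbb Z$. -/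

import Mathlib

namespace Freudenthal

/-! ## The split composition rings over the integers -/

/-- The operations of a composition ring over `ℤ` (product, conjugation, norm, trace).
The class is only used at the three concrete rings `BinZ`, `QuatZ`, `OctZ` below. -/
class CompositionOps (C : Type) where
  /-- the product -/
  cmul : C → C → C
  /-- the conjugation -/
  conj : C → C
  /-- the norm -/
  nrm : C → ℤ
  /-- the trace -/
  trc : C → ℤ

/-- Split integral quaternions: the `2 × 2` integer matrices. -/
abbrev QuatZ : Type := Matrix (Fin 2) (Fin 2) ℤ

/-- Matrix product, symplectic involution `(a, b; c, d) ↦ (d, -b; -c, a)` (the adjugate),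
determinant and matrix trace. -/
instance : CompositionOps QuatZ where
  cmul p q := p * q
  conj p := p.adjugate
  nrm p := p.det
  trc p := p.trace

/-- Split integral binarions: the diagonal matrix `diag(a, d)` in `QuatZ` is written as the pair
`(a, d)`. -/
abbrev BinZ : Type := ℤ × ℤ

/-- The operations induced from `QuatZ` on diagonal matrices. -/
instance : CompositionOps BinZ where
  cmul p q := (p.1 * q.1, p.2 * q.2)
  conj p := (p.2, p.1)
  nrm p := p.1 * p.2
  trc p := p.1 + p.2

/-- Split integral octonions: the Cayley-Dickson double of `QuatZ`; the pair `(a, b)` is the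
octonion `a + b v`. -/
abbrev OctZ : Type := QuatZ × QuatZ

/-- `(a + b v)(c + d v) = (a c - d̄ b) + (d a + b c̄) v`, `conj (a + b v) = ā - b v`,
`n(a + b v) = det a + det b`, `t(a + b v) = t(a)`. -/
instance : CompositionOps OctZ where
  cmul p q := (p.1 * q.1 - q.2.adjugate * p.2, q.2 * p.1 + p.2 * q.1.adjugate)
  conj p := (p.1.adjugate, -p.2)
  nrm p := p.1.det + p.2.det
  trc p := p.1.trace

open CompositionOps

/-! ## Hermitian `3 × 3` matrices -/

/-- The `3 × 3` Hermitian matrix over `C` with rows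
`(a, z, ȳ)`, `(z̄, b, x)`, `(y, x̄, c)`, where `a b c : ℤ` and `x y z : C`. -/
@[ext] structure H3 (C : Type) where
  a : ℤ
  b : ℤ
  c : ℤ
  x : C
  y : C
  z : C

namespace H3

section Additive

variable {C : Type}

/-- The entries of a Hermitian matrix. -/
def entries (A : H3 C) : ℤ × ℤ × ℤ × C × C × C := (A.a, A.b, A.c, A.x, A.y, A.z)

theorem entries_injective : Function.Injective (entries (C := C)) := by
  intro A B h
  simp only [entries, Prod.mk.injEq] at h
  obtain ⟨h1, h2, h3, h4, h5, h6⟩ := h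
  exact H3.ext h1 h2 h3 h4 h5 h6

variable [AddCommGroup C]

instance : Zero (H3 C) := ⟨⟨0, 0, 0, 0, 0, 0⟩⟩
instance : Add (H3 C) :=
  ⟨fun A B => ⟨A.a + B.a, A.b + B.b, A.c + B.c, A.x + B.x, A.y + B.y, A.z + B.z⟩⟩
instance : Neg (H3 C) := ⟨fun A => ⟨-A.a, -A.b, -A.c, -A.x, -A.y, -A.z⟩⟩
instance : Sub (H3 C) :=
  ⟨fun A B => ⟨A.a - B.a, A.b - B.b, A.c - B.c, A.x - B.x, A.y - B.y, A.z - B.z⟩⟩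
instance : SMul ℕ (H3 C) :=
  ⟨fun n A => ⟨n • A.a, n • A.b, n • A.c, n • A.x, n • A.y, n • A.z⟩⟩
instance : SMul ℤ (H3 C) :=
  ⟨fun n A => ⟨n • A.a, n • A.b, n • A.c, n • A.x, n • A.y, n • A.z⟩⟩

/-- Entrywise addition. -/
instance : AddCommGroup (H3 C) :=
  entries_injective.addCommGroup entries rfl (fun _ _ => rfl) (fun _ => rfl) (fun _ _ => rfl)
    (fun _ _ => rfl) (fun _ _ => rfl)

end Additive

variable {C : Type} [AddCommGroup C] [CompositionOps C]

/-- The diagonal matrix `diag(d₁, d₂, d₃)`. -/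
def diag (d₁ d₂ d₃ : ℤ) : H3 C := ⟨d₁, d₂, d₃, 0, 0, 0⟩

/-- The cubic norm
`N(A) = abc - a n(x) - b n(y) - c n(z) + t((xy)z)`. -/
def N (A : H3 C) : ℤ :=
  A.a * A.b * A.c - A.a * nrm A.x - A.b * nrm A.y - A.c * nrm A.z
    + trc (cmul (cmul A.x A.y) A.z)

/-- The trace bilinear form `(A, B) = tr (½ (AB + BA))`, written in coordinates. -/
def bil (A B : H3 C) : ℤ :=
  A.a * B.a + A.b * B.b + A.c * B.c
    + trc (cmul A.x (conj B.x)) + trc (cmul A.y (conj B.y)) + trc (cmul A.z (conj B.z))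

/-- The sharp map `A ↦ A^#` (the adjoint matrix). -/
def sharp (A : H3 C) : H3 C where
  a := A.b * A.c - nrm A.x
  b := A.a * A.c - nrm A.y
  c := A.a * A.b - nrm A.z
  x := cmul (conj A.z) (conj A.y) - A.a • A.x
  y := cmul (conj A.x) (conj A.z) - A.b • A.y
  z := cmul (conj A.y) (conj A.x) - A.c • A.z

/-- The linearization `A × B = (A + B)^# - A^# - B^#` of the sharp map. -/
def cross (A B : H3 C) : H3 C := sharp (A + B) - sharp A - sharp B

/-- `s` belongs to the norm-preserving group of `H₃(C)`. -/
def IsNormPreserving (s : H3 C ≃ₗ[ℤ] H3 C) : Prop := ∀ A, N (s A) = N A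

/-- `s'` is the adjoint `s^*` of `s` with respect to the trace bilinear form. -/
def IsAdjoint (s s' : H3 C ≃ₗ[ℤ] H3 C) : Prop := ∀ A B, bil (s A) B = bil A (s' B)

end H3

/-! ## The module `M(J) = ℤ ⊕ ℤ ⊕ J ⊕ J` -/

/-- The element `(α, β, A, B)` of `M(J) = ℤ ⊕ ℤ ⊕ J ⊕ J`. -/
@[ext] structure M (J : Type) where
  α : ℤ
  β : ℤ
  A : J
  B : J

namespace M

section Additive

variable {J : Type}

/-- The components of an element of `M(J)`. -/
def entries (u : M J) : ℤ × ℤ × J × J := (u.α, u.β, u.A, u.B)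

theorem entries_injective : Function.Injective (entries (J := J)) := by
  intro u v h
  simp only [entries, Prod.mk.injEq] at h
  obtain ⟨h1, h2, h3, h4⟩ := h
  exact M.ext h1 h2 h3 h4

variable [AddCommGroup J]

instance : Zero (M J) := ⟨⟨0, 0, 0, 0⟩⟩
instance : Add (M J) := ⟨fun u v => ⟨u.α + v.α, u.β + v.β, u.A + v.A, u.B + v.B⟩⟩
instance : Neg (M J) := ⟨fun u => ⟨-u.α, -u.β, -u.A, -u.B⟩⟩
instance : Sub (M J) := ⟨fun u v => ⟨u.α - v.α, u.β - v.β, u.A - v.A, u.B - v.B⟩⟩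
instance : SMul ℕ (M J) := ⟨fun n u => ⟨n • u.α, n • u.β, n • u.A, n • u.B⟩⟩
instance : SMul ℤ (M J) := ⟨fun n u => ⟨n • u.α, n • u.β, n • u.A, n • u.B⟩⟩

/-- Componentwise addition. -/
instance : AddCommGroup (M J) :=
  entries_injective.addCommGroup entries rfl (fun _ _ => rfl) (fun _ => rfl) (fun _ _ => rfl)
    (fun _ _ => rfl) (fun _ _ => rfl)

end Additive

open H3

variable {C : Type} [AddCommGroup C] [CompositionOps C]

/-- The skew-symmetric form `{u, v}`. -/
def symp (u v : M (H3 C)) : ℤ :=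
  u.α * v.β - u.β * v.α + bil u.A v.B - bil u.B v.A

/-- The quartic form `q`. -/
def q (u : M (H3 C)) : ℤ :=
  8 * bil (sharp u.A) (sharp u.B) - 8 * u.α * N u.A - 8 * u.β * N u.B
    - 2 * (bil u.A u.B - u.α * u.β) ^ 2

/-- The modified quartic form `q'`, with `q = -2 q'`. -/
def q' (u : M (H3 C)) : ℤ :=
  -4 * bil (sharp u.A) (sharp u.B) + 4 * u.α * N u.A + 4 * u.β * N u.B
    + (bil u.A u.B - u.α * u.β) ^ 2

/-- `g` belongs to the group `G_ℤ` of invertible `ℤ`-linear transformations of `M(J_ℤ)` that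
preserve `q` and `{·, ·}`. -/
def IsAutomorphism (g : M (H3 C) ≃ₗ[ℤ] M (H3 C)) : Prop :=
  (∀ u v, symp (g u) (g v) = symp u v) ∧ ∀ u, q (g u) = q u

/-- The elementary transformation `φ(D)`. -/
def phi (D : H3 C) (u : M (H3 C)) : M (H3 C) where
  α := u.α + bil u.B D + bil u.A (sharp D) + u.β * N D
  β := u.β
  A := u.A + u.β • D
  B := u.B + cross u.A D + u.β • sharp D

/-- The elementary transformation `ψ(D)`. -/
def psi (D : H3 C) (u : M (H3 C)) : M (H3 C) where
  α := u.α
  β := u.β + bil u.A D + bil u.B (sharp D) + u.α * N D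
  A := u.A + cross u.B D + u.α • sharp D
  B := u.B + u.α • D

/-- The elementary transformation `T(s)` of a norm-preserving `s` with adjoint `s' = s^*`:
`(α, β, A, B) ↦ (α, β, s(A), s^*⁻¹(B))`. -/
def tf (s s' : H3 C ≃ₗ[ℤ] H3 C) (u : M (H3 C)) : M (H3 C) where
  α := u.α
  β := u.β
  A := s u.A
  B := s'.symm u.B

/-- The elementary transformation `τ`. -/
def tau (u : M (H3 C)) : M (H3 C) where
  α := -u.β
  β := u.α
  A := -u.B
  B := u.A

/-- `v` is the image of `u` under one of the elementary transformations
`φ(D)`, `ψ(D)`, `T(s)`, `τ` with `D` in `J_ℤ` and `s` in the norm-preserving group of `J_ℤ`. -/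
inductive ElementaryStep : M (H3 C) → M (H3 C) → Prop
  | phi (D : H3 C) (u : M (H3 C)) : ElementaryStep u (phi D u)
  | psi (D : H3 C) (u : M (H3 C)) : ElementaryStep u (psi D u)
  | tf (s s' : H3 C ≃ₗ[ℤ] H3 C) (hs : IsNormPreserving s) (hs' : IsAdjoint s s')
      (u : M (H3 C)) : ElementaryStep u (tf s s' u)
  | tau (u : M (H3 C)) : ElementaryStep u (tau u)

/-- `u` is carried to `v` by a finite series of elementary transformations. -/
def ElementaryEquiv (u v : M (H3 C)) : Prop := Relation.ReflTransGen ElementaryStep u v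

/-- The binary quadratic form `p X² + r XY + t Y²` is primitive. -/
def IsPrimitiveForm (p r t : ℤ) : Prop := Int.gcd p (Int.gcd r t) = 1

/-- Projectivity of `(α, β, (a₀, a₁, a₂), (b₀, b₁, b₂))` in `M(ℤ ⊕ ℤ ⊕ ℤ)`: its three
associated binary quadratic forms are primitive. -/
def IsProjectiveDiag (u : M (Fin 3 → ℤ)) : Prop :=
  IsPrimitiveForm (u.α * u.A 0 - u.B 1 * u.B 2)
    (-(u.A 0 * u.B 0) + u.A 1 * u.B 1 + u.A 2 * u.B 2 - u.α * u.β)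
    (u.β * u.B 0 - u.A 1 * u.A 2) ∧
  IsPrimitiveForm (u.α * u.A 1 - u.B 2 * u.B 0)
    (u.A 0 * u.B 0 - u.A 1 * u.B 1 + u.A 2 * u.B 2 - u.α * u.β)
    (u.β * u.B 1 - u.A 2 * u.A 0) ∧
  IsPrimitiveForm (u.α * u.A 2 - u.B 0 * u.B 1)
    (u.A 0 * u.B 0 + u.A 1 * u.B 1 - u.A 2 * u.B 2 - u.α * u.β)
    (u.β * u.B 2 - u.A 0 * u.A 1)

/-- Reduced elements `(α, β, (a₀, a₁, a₂), 0)` of `M(ℤ ⊕ ℤ ⊕ ℤ)`: `α > 0`, `α ∣ β`, `α ∣ aᵢ`. -/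
def IsReducedDiag (u : M (Fin 3 → ℤ)) : Prop :=
  0 < u.α ∧ u.α ∣ u.β ∧ (∀ i, u.α ∣ u.A i) ∧ u.B = 0

/-- The inclusion `M(ℤ ⊕ ℤ ⊕ ℤ) ⊂ M(H₃(C))` induced by the diagonal embedding. -/
def ofDiag (u : M (Fin 3 → ℤ)) : M (H3 C) where
  α := u.α
  β := u.β
  A := diag (u.A 0) (u.A 1) (u.A 2)
  B := diag (u.B 0) (u.B 1) (u.B 2)

/-- `x` in `M(H₃(C))` is projective: its `G_ℤ`-orbit contains a diagonal reduced element which is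
projective as an element of `M(ℤ ⊕ ℤ ⊕ ℤ)`. -/
def IsProjective (x : M (H3 C)) : Prop :=
  ∃ g : M (H3 C) ≃ₗ[ℤ] M (H3 C), IsAutomorphism g ∧
    ∃ u : M (Fin 3 → ℤ), IsReducedDiag u ∧ IsProjectiveDiag u ∧ g x = ofDiag u

/-- The element `(1, ε, diag(1, 1, k), 0)`. -/
def normalForm (ε k : ℤ) : M (H3 C) := ⟨1, ε, diag 1 1 k, 0⟩

end M

end Freudenthal

namespace Freudenthal

set_option linter.unusedSectionVars false

open CompositionOps

/-! Projectivity enters only through a local invariant. Take half the linear coefficient of `t ↦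
q'(u + t y)` as a functional of `y`, and call `u` degenerate at a prime `p` if this functional is
congruent to `2l{u, y}` for some integer `l`, modulo `p`, or modulo 4 when `p = 2`. The notion
involves only `q'` and the symplectic form, so it is respected by `G_ℤ` and by the elementary
transformations. An element `(1, β, A, 0)` is degenerate at `p` as soon as `p` divides `β`, `A^#`
and `N(A)` (`isDegenerate_of_dvd_sharp`). For a reduced diagonal element, degeneracy forces `p` to
divide `β` and all products of two diagonal entries, so some associated binary form is not primitive
(`not_isDegenerate_ofDiag`). Hence projective elements are degenerate at no prime.

From there the argument is Euclidean. The smallest positive `α` reachable from `u` divides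
everything else after `B` is cleared, so nondegeneracy makes it 1 (`exists_elementaryEquiv_one`).
Permutations and shears preserve `N` and bring `A` to `diag(a, b, c)` with `a ∣ b ∣ c`
(`exists_normEquiv_diag`). The transformation `ElementaryEquiv.move` changes `c` to `c + β - ab`.
After a second diagonalization, a prime dividing the new first entry would divide the old `a, b, c`
and `β`, so that entry is a unit. Repeating this with the adjoint matrix in place of the matrix
gives two unit entries. They become 1 because the norm of `C` represents every integer, and a last
move reduces `β` modulo 2.

Form invariance of `φ(D)` is checked on rank-one `D`, which generate `J` additively; `ψ` is
conjugate to `φ` under `τ`. Invariance of `q'` and the parity of `4k + ε²` give uniqueness. -/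

/-- A null element that pairs to `1` with some other element under the trace form. -/
def IsHyperbolic {C : Type} [AddCommGroup C] [CompositionOps C] (e : C) : Prop :=
  nrm e = 0 ∧ ∃ f, trc (cmul f (conj e)) = 1

/-- The laws of a unital split composition ring over `ℤ` that are used below. -/
class IsSplitComposition (C : Type) [AddCommGroup C] [CompositionOps C] : Prop where
  add_cmul : ∀ x y z : C, cmul (x + y) z = cmul x z + cmul y z
  cmul_add : ∀ x y z : C, cmul x (y + z) = cmul x y + cmul x z
  conj_add : ∀ x y : C, conj (x + y) = conj x + conj y
  trc_add : ∀ x y : C, trc (x + y) = trc x + trc y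
  conj_conj : ∀ x : C, conj (conj x) = x
  conj_cmul : ∀ x y : C, conj (cmul x y) = cmul (conj y) (conj x)
  trc_conj : ∀ x : C, trc (conj x) = trc x
  trc_comm : ∀ x y : C, trc (cmul x y) = trc (cmul y x)
  trc_assoc : ∀ x y z : C, trc (cmul x (cmul y z)) = trc (cmul (cmul x y) z)
  nrm_add : ∀ x y : C, nrm (x + y) = nrm x + nrm y + trc (cmul x (conj y))
  nrm_zsmul : ∀ (m : ℤ) (x : C), nrm (m • x) = m ^ 2 * nrm x
  nrm_cmul : ∀ x y : C, nrm (cmul x y) = nrm x * nrm y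
  nrm_conj : ∀ x : C, nrm (conj x) = nrm x
  trc_self : ∀ x : C, trc (cmul x (conj x)) = 2 * nrm x
  conj_cmul_cancel : ∀ x y : C, cmul (conj x) (cmul x y) = nrm x • y
  moufang : ∀ x y z : C, cmul (cmul x y) (cmul z x) =
    trc (cmul (cmul x y) z) • x - nrm x • cmul (conj z) (conj y)
  exists_one : ∃ u : C, ∀ x, cmul x u = x
  exists_nrm : ∀ m : ℤ, ∃ x : C, nrm x = m
  closure_isHyperbolic : AddSubgroup.closure {e : C | IsHyperbolic e} = ⊤
  exists_eq_zsmul : ∀ (d : ℤ) (x : C), (∀ w, d ∣ trc (cmul x (conj w))) → ∃ x', x = d • x'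

/-! ### The three rings satisfy the split composition laws. -/

section Instances

theorem BinZ.cmul_def (p q : BinZ) : cmul p q = (p.1 * q.1, p.2 * q.2) := rfl
theorem BinZ.conj_def (p : BinZ) : conj p = (p.2, p.1) := rfl
theorem BinZ.nrm_def (p : BinZ) : nrm p = p.1 * p.2 := rfl
theorem BinZ.trc_def (p : BinZ) : trc p = p.1 + p.2 := rfl

instance : IsSplitComposition BinZ where
  add_cmul x y z := by ext <;> simp [BinZ.cmul_def, add_mul]
  cmul_add x y z := by ext <;> simp [BinZ.cmul_def, mul_add]
  conj_add x y := rfl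
  trc_add x y := by simp only [BinZ.trc_def, Prod.fst_add, Prod.snd_add]; ring
  conj_conj x := rfl
  conj_cmul x y := by ext <;> simp [BinZ.cmul_def, BinZ.conj_def, mul_comm]
  trc_conj x := by simp [BinZ.trc_def, BinZ.conj_def, add_comm]
  trc_comm x y := by simp [BinZ.trc_def, BinZ.cmul_def, mul_comm]
  trc_assoc x y z := by simp [BinZ.trc_def, BinZ.cmul_def, mul_assoc]
  nrm_add x y := by
    simp only [BinZ.nrm_def, BinZ.trc_def, BinZ.cmul_def, BinZ.conj_def, Prod.fst_add,
      Prod.snd_add]; ring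
  nrm_zsmul m x := by
    simp only [BinZ.nrm_def, Prod.smul_fst, Prod.smul_snd, smul_eq_mul]; ring
  nrm_cmul x y := by simp only [BinZ.nrm_def, BinZ.cmul_def]; ring
  nrm_conj x := by simp [BinZ.nrm_def, BinZ.conj_def, mul_comm]
  trc_self x := by simp only [BinZ.nrm_def, BinZ.trc_def, BinZ.cmul_def, BinZ.conj_def]; ring
  conj_cmul_cancel x y := by
    ext <;> simp only [BinZ.nrm_def, BinZ.cmul_def, BinZ.conj_def, Prod.smul_fst, Prod.smul_snd,
      smul_eq_mul] <;> ring
  moufang x y z := by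
    ext <;> simp only [BinZ.nrm_def, BinZ.trc_def, BinZ.cmul_def, BinZ.conj_def, Prod.smul_fst,
      Prod.smul_snd, Prod.fst_sub, Prod.snd_sub, smul_eq_mul] <;> ring
  exists_one := ⟨(1, 1), fun x => by simp [BinZ.cmul_def]⟩
  exists_nrm m := ⟨(1, m), by simp [BinZ.nrm_def]⟩
  closure_isHyperbolic := by
    refine eq_top_iff.2 fun x _ => ?_
    have h1 : ((1, 0) : BinZ) ∈ AddSubgroup.closure {e : BinZ | IsHyperbolic e} :=
      AddSubgroup.subset_closure ⟨rfl, (0, 1), rfl⟩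
    have h2 : ((0, 1) : BinZ) ∈ AddSubgroup.closure {e : BinZ | IsHyperbolic e} :=
      AddSubgroup.subset_closure ⟨rfl, (1, 0), rfl⟩
    have : x = x.1 • ((1, 0) : BinZ) + x.2 • ((0, 1) : BinZ) := by ext <;> simp
    rw [this]
    exact add_mem (zsmul_mem h1 _) (zsmul_mem h2 _)
  exists_eq_zsmul d x h := by
    obtain ⟨p, hp⟩ := h (0, 1)
    obtain ⟨q, hq⟩ := h (1, 0)
    simp only [BinZ.trc_def, BinZ.cmul_def, BinZ.conj_def, mul_one, mul_zero, add_zero,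
      zero_add] at hp hq
    exact ⟨(p, q), Prod.ext hp hq⟩

theorem QuatZ.cmul_def (p q : QuatZ) : cmul p q = p * q := rfl
theorem QuatZ.conj_def (p : QuatZ) : conj p = p.adjugate := rfl
theorem QuatZ.nrm_def (p : QuatZ) : nrm p = p.det := rfl
theorem QuatZ.trc_def (p : QuatZ) : trc p = p.trace := rfl

theorem QuatZ.ext_entries {p q : QuatZ} (h00 : p 0 0 = q 0 0) (h01 : p 0 1 = q 0 1)
    (h10 : p 1 0 = q 1 0) (h11 : p 1 1 = q 1 1) : p = q := by
  ext i j
  fin_cases i <;> fin_cases j <;> assumption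

theorem QuatZ.zsmul_apply (m : ℤ) (p : QuatZ) (i j : Fin 2) : (m • p) i j = m * p i j := rfl

theorem QuatZ.eq_sum (p : QuatZ) : p = p 0 0 • !![1, 0; 0, 0] + p 0 1 • !![0, 1; 0, 0] +
    p 1 0 • !![0, 0; 1, 0] + p 1 1 • !![0, 0; 0, 1] := by
  apply QuatZ.ext_entries <;> simp

theorem QuatZ.mul_entry (p q : QuatZ) (i j : Fin 2) :
    (p * q) i j = p i 0 * q 0 j + p i 1 * q 1 j := by
  simp [Matrix.mul_apply, Fin.sum_univ_two]

theorem QuatZ.adj00 (p : QuatZ) : p.adjugate 0 0 = p 1 1 := by simp [Matrix.adjugate_fin_two]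
theorem QuatZ.adj01 (p : QuatZ) : p.adjugate 0 1 = -p 0 1 := by simp [Matrix.adjugate_fin_two]
theorem QuatZ.adj10 (p : QuatZ) : p.adjugate 1 0 = -p 1 0 := by simp [Matrix.adjugate_fin_two]
theorem QuatZ.adj11 (p : QuatZ) : p.adjugate 1 1 = p 0 0 := by simp [Matrix.adjugate_fin_two]

theorem QuatZ.isHyperbolic_of_mem {p : QuatZ}
    (h : p ∈ ({!![1, 0; 0, 0], !![0, 1; 0, 0], !![0, 0; 1, 0], !![0, 0; 0, 1]} : Set QuatZ)) :
    nrm p = 0 ∧ ∃ f : QuatZ, trc (cmul f (conj p)) = 1 := by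
  simp only [Set.mem_insert_iff, Set.mem_singleton_iff] at h
  rcases h with rfl | rfl | rfl | rfl
  · exact ⟨by simp [QuatZ.nrm_def], !![0, 0; 0, 1], by
      simp [QuatZ.trc_def, QuatZ.cmul_def, QuatZ.conj_def, Matrix.trace_fin_two]⟩
  · exact ⟨by simp [QuatZ.nrm_def], !![0, 0; -1, 0], by
      simp [QuatZ.trc_def, QuatZ.cmul_def, QuatZ.conj_def, Matrix.trace_fin_two]⟩
  · exact ⟨by simp [QuatZ.nrm_def], !![0, -1; 0, 0], by
      simp [QuatZ.trc_def, QuatZ.cmul_def, QuatZ.conj_def, Matrix.trace_fin_two]⟩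
  · exact ⟨by simp [QuatZ.nrm_def], !![1, 0; 0, 0], by
      simp [QuatZ.trc_def, QuatZ.cmul_def, QuatZ.conj_def, Matrix.trace_fin_two]⟩

theorem QuatZ.mem_of_basis (S : AddSubgroup QuatZ)
    (h : ∀ p ∈ ({!![1, 0; 0, 0], !![0, 1; 0, 0], !![0, 0; 1, 0], !![0, 0; 0, 1]} : Set QuatZ),
      p ∈ S) (x : QuatZ) : x ∈ S := by
  rw [QuatZ.eq_sum x]
  exact add_mem (add_mem (add_mem (zsmul_mem (h _ (by simp)) _) (zsmul_mem (h _ (by simp)) _))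
    (zsmul_mem (h _ (by simp)) _)) (zsmul_mem (h _ (by simp)) _)

theorem QuatZ.eq_zsmul_of_trc (d : ℤ) (x : QuatZ) (h : ∀ w : QuatZ, d ∣ trc (cmul x (conj w))) :
    ∃ x' : QuatZ, x = d • x' := by
  -- The adjugates of these four matrices are the matrix units up to order, so the traces read off
  -- the entries of `x`.
  obtain ⟨p, hp⟩ := h !![0, 0; 0, 1]
  obtain ⟨q, hq⟩ := h !![0, 0; -1, 0]
  obtain ⟨r, hr⟩ := h !![0, -1; 0, 0]
  obtain ⟨s, hs⟩ := h !![1, 0; 0, 0]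
  refine ⟨!![p, q; r, s], ?_⟩
  simp [QuatZ.trc_def, QuatZ.cmul_def, QuatZ.conj_def, Matrix.trace_fin_two,
    QuatZ.mul_entry] at hp hq hr hs
  apply QuatZ.ext_entries <;> simpa

instance : IsSplitComposition QuatZ where
  add_cmul x y z := add_mul x y z
  cmul_add x y z := mul_add x y z
  conj_add x y := by
    apply QuatZ.ext_entries <;> simp [QuatZ.conj_def, Matrix.adjugate_fin_two] <;> ring
  trc_add x y := Matrix.trace_add x y
  conj_conj x := by
    apply QuatZ.ext_entries <;> simp [QuatZ.conj_def, Matrix.adjugate_fin_two]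
  conj_cmul x y := Matrix.adjugate_mul_distrib x y
  trc_conj x := by
    simp [QuatZ.trc_def, QuatZ.conj_def, Matrix.trace_fin_two, Matrix.adjugate_fin_two, add_comm]
  trc_comm x y := Matrix.trace_mul_comm x y
  trc_assoc x y z := by simp only [QuatZ.trc_def, QuatZ.cmul_def, mul_assoc]
  nrm_add x y := by
    simp only [QuatZ.nrm_def, QuatZ.trc_def, QuatZ.cmul_def, QuatZ.conj_def, Matrix.det_fin_two,
      Matrix.trace_fin_two, QuatZ.mul_entry, Matrix.add_apply, QuatZ.adj00, QuatZ.adj01,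
      QuatZ.adj10, QuatZ.adj11]
    ring
  nrm_zsmul m x := by
    simp only [QuatZ.nrm_def, Matrix.det_fin_two, QuatZ.zsmul_apply]
    ring
  nrm_cmul x y := Matrix.det_mul x y
  nrm_conj x := by
    simp only [QuatZ.nrm_def, QuatZ.conj_def, Matrix.det_fin_two, QuatZ.adj00, QuatZ.adj01,
      QuatZ.adj10, QuatZ.adj11]
    ring
  trc_self x := by
    simp only [QuatZ.nrm_def, QuatZ.trc_def, QuatZ.cmul_def, QuatZ.conj_def, Matrix.det_fin_two,
      Matrix.trace_fin_two, QuatZ.mul_entry, QuatZ.adj00, QuatZ.adj01, QuatZ.adj10, QuatZ.adj11]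
    ring
  conj_cmul_cancel x y := by
    apply QuatZ.ext_entries <;>
    simp only [QuatZ.nrm_def, QuatZ.cmul_def, QuatZ.conj_def, Matrix.det_fin_two, QuatZ.zsmul_apply,
      QuatZ.mul_entry, QuatZ.adj00, QuatZ.adj01, QuatZ.adj10, QuatZ.adj11] <;>
    ring
  moufang x y z := by
    apply QuatZ.ext_entries <;>
    simp only [QuatZ.nrm_def, QuatZ.trc_def, QuatZ.cmul_def, QuatZ.conj_def, Matrix.det_fin_two,
      Matrix.trace_fin_two, QuatZ.zsmul_apply, Matrix.sub_apply, QuatZ.mul_entry, QuatZ.adj00,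
      QuatZ.adj01, QuatZ.adj10, QuatZ.adj11] <;>
    ring
  exists_one := ⟨1, fun x => mul_one x⟩
  exists_nrm m := ⟨!![1, 0; 0, m], by simp [QuatZ.nrm_def]⟩
  closure_isHyperbolic := eq_top_iff.2 fun x _ => QuatZ.mem_of_basis _
    (fun _ hp => AddSubgroup.subset_closure (QuatZ.isHyperbolic_of_mem hp)) x
  exists_eq_zsmul := QuatZ.eq_zsmul_of_trc

theorem OctZ.cmul_def (p q : OctZ) : cmul p q =
  (p.1 * q.1 - q.2.adjugate * p.2, q.2 * p.1 + p.2 * q.1.adjugate) := rfl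
theorem OctZ.conj_def (p : OctZ) : conj p = (p.1.adjugate, -p.2) := rfl
theorem OctZ.nrm_def (p : OctZ) : nrm p = p.1.det + p.2.det := rfl
theorem OctZ.trc_def (p : OctZ) : trc p = p.1.trace := rfl

theorem OctZ.ext_entries {p q : OctZ} (h00 : p.1 0 0 = q.1 0 0) (h01 : p.1 0 1 = q.1 0 1)
    (h10 : p.1 1 0 = q.1 1 0) (h11 : p.1 1 1 = q.1 1 1) (k00 : p.2 0 0 = q.2 0 0)
    (k01 : p.2 0 1 = q.2 0 1) (k10 : p.2 1 0 = q.2 1 0) (k11 : p.2 1 1 = q.2 1 1) : p = q :=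
  Prod.ext (QuatZ.ext_entries h00 h01 h10 h11) (QuatZ.ext_entries k00 k01 k10 k11)

theorem OctZ.zsmul_fst (m : ℤ) (p : OctZ) : (m • p).1 = m • p.1 := rfl
theorem OctZ.zsmul_snd (m : ℤ) (p : OctZ) : (m • p).2 = m • p.2 := rfl

theorem OctZ.trc_inl (f p : QuatZ) :
    trc (cmul ((f, 0) : OctZ) (conj ((p, 0) : OctZ))) = trc (cmul f (conj p)) := by
  simp [OctZ.trc_def, OctZ.cmul_def, OctZ.conj_def, QuatZ.trc_def, QuatZ.cmul_def, QuatZ.conj_def]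

theorem OctZ.trc_cmul_conj (f p : OctZ) :
    trc (cmul f (conj p)) = trc (cmul f.1 (conj p.1)) + trc (cmul f.2 (conj p.2)) := by
  simp only [OctZ.trc_def, OctZ.cmul_def, OctZ.conj_def, QuatZ.trc_def, QuatZ.cmul_def,
    QuatZ.conj_def, Matrix.trace_fin_two, QuatZ.mul_entry, Matrix.sub_apply, Matrix.neg_apply,
      QuatZ.adj00, QuatZ.adj01, QuatZ.adj10, QuatZ.adj11]
  ring

theorem OctZ.trc_inr (f p : QuatZ) :
    trc (cmul ((0, f) : OctZ) (conj ((0, p) : OctZ))) = trc (cmul f (conj p)) := by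
  rw [OctZ.trc_cmul_conj]
  simp [QuatZ.trc_def, QuatZ.cmul_def]

instance : IsSplitComposition OctZ where
  add_cmul x y z := by
    apply OctZ.ext_entries <;>
    simp only [OctZ.cmul_def, Prod.fst_add, Prod.snd_add, Matrix.add_apply, Matrix.sub_apply,
      QuatZ.mul_entry, QuatZ.adj00, QuatZ.adj01, QuatZ.adj10, QuatZ.adj11] <;>
    ring
  cmul_add x y z := by
    apply OctZ.ext_entries <;>
    simp only [OctZ.cmul_def, Prod.fst_add, Prod.snd_add, Matrix.add_apply, Matrix.sub_apply,
      QuatZ.mul_entry, QuatZ.adj00, QuatZ.adj01, QuatZ.adj10, QuatZ.adj11] <;>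
    ring
  conj_add x y := by
    apply OctZ.ext_entries <;>
    simp only [OctZ.conj_def, Prod.fst_add, Prod.snd_add, Matrix.add_apply, Matrix.neg_apply,
      QuatZ.adj00, QuatZ.adj01, QuatZ.adj10, QuatZ.adj11] <;>
    ring
  trc_add x y := Matrix.trace_add x.1 y.1
  conj_conj x := by
    apply OctZ.ext_entries <;>
    simp only [OctZ.conj_def, QuatZ.adj00, QuatZ.adj01, QuatZ.adj10, QuatZ.adj11, neg_neg]
  conj_cmul x y := by
    apply OctZ.ext_entries <;>
    simp only [OctZ.cmul_def, OctZ.conj_def, Matrix.add_apply, Matrix.sub_apply, Matrix.neg_apply,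
      QuatZ.mul_entry, QuatZ.adj00, QuatZ.adj01, QuatZ.adj10, QuatZ.adj11] <;>
    ring
  trc_conj x := by
    simp only [OctZ.trc_def, OctZ.conj_def, Matrix.trace_fin_two, QuatZ.adj00, QuatZ.adj11]
    ring
  trc_comm x y := by
    simp only [OctZ.trc_def, OctZ.cmul_def, Matrix.trace_fin_two, Matrix.sub_apply,
      QuatZ.mul_entry, QuatZ.adj00, QuatZ.adj01, QuatZ.adj10, QuatZ.adj11]
    ring
  trc_assoc x y z := by
    simp only [OctZ.trc_def, OctZ.cmul_def, Matrix.trace_fin_two, Matrix.sub_apply,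
      Matrix.add_apply, QuatZ.mul_entry, QuatZ.adj00, QuatZ.adj01, QuatZ.adj10, QuatZ.adj11]
    ring
  nrm_add x y := by
    simp only [OctZ.nrm_def, OctZ.trc_def, OctZ.cmul_def, OctZ.conj_def, Matrix.det_fin_two,
      Matrix.trace_fin_two, QuatZ.mul_entry, Prod.fst_add, Prod.snd_add, Matrix.add_apply,
      Matrix.sub_apply, Matrix.neg_apply, QuatZ.adj00, QuatZ.adj01, QuatZ.adj10, QuatZ.adj11]
    ring
  nrm_zsmul m x := by
    simp only [OctZ.nrm_def, Matrix.det_fin_two, OctZ.zsmul_fst, OctZ.zsmul_snd,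
      QuatZ.zsmul_apply]
    ring
  nrm_cmul x y := by
    simp only [OctZ.nrm_def, OctZ.cmul_def, Matrix.det_fin_two, QuatZ.mul_entry, Matrix.add_apply,
      Matrix.sub_apply, QuatZ.adj00, QuatZ.adj01, QuatZ.adj10, QuatZ.adj11]
    ring
  nrm_conj x := by
    simp only [OctZ.nrm_def, OctZ.conj_def, Matrix.det_fin_two, Matrix.neg_apply, QuatZ.adj00,
      QuatZ.adj01, QuatZ.adj10, QuatZ.adj11]
    ring
  trc_self x := by
    rw [OctZ.trc_cmul_conj, IsSplitComposition.trc_self, IsSplitComposition.trc_self]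
    exact (mul_add 2 _ _).symm
  conj_cmul_cancel x y := by
    apply OctZ.ext_entries <;>
    simp only [OctZ.nrm_def, OctZ.cmul_def, OctZ.conj_def, Matrix.det_fin_two, OctZ.zsmul_fst,
      OctZ.zsmul_snd, QuatZ.zsmul_apply, QuatZ.mul_entry, Matrix.add_apply, Matrix.sub_apply,
      Matrix.neg_apply, QuatZ.adj00, QuatZ.adj01, QuatZ.adj10, QuatZ.adj11] <;>
    ring
  moufang x y z := by
    apply OctZ.ext_entries <;>
    simp only [OctZ.nrm_def, OctZ.trc_def, OctZ.cmul_def, OctZ.conj_def, Matrix.det_fin_two,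
      Matrix.trace_fin_two, OctZ.zsmul_fst, OctZ.zsmul_snd, QuatZ.zsmul_apply, Prod.fst_sub,
      Prod.snd_sub, Matrix.add_apply, Matrix.sub_apply, Matrix.neg_apply, QuatZ.mul_entry,
      QuatZ.adj00, QuatZ.adj01, QuatZ.adj10, QuatZ.adj11] <;>
    ring
  exists_one := ⟨(1, 0), fun x => by simp [OctZ.cmul_def]⟩
  exists_nrm m := ⟨(!![1, 0; 0, m], 0), by simp [OctZ.nrm_def]⟩
  closure_isHyperbolic := by
    refine eq_top_iff.2 fun x _ => ?_
    set S := AddSubgroup.closure {e : OctZ | IsHyperbolic e}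
    have h1 : ((x.1, 0) : OctZ) ∈ S := by
      refine QuatZ.mem_of_basis (S.comap (AddMonoidHom.inl QuatZ QuatZ)) (fun p hp => ?_) x.1
      obtain ⟨hn, f, hf⟩ := QuatZ.isHyperbolic_of_mem hp
      refine AddSubgroup.subset_closure ⟨?_, (f, 0), (OctZ.trc_inl f p).trans hf⟩
      simpa [OctZ.nrm_def, QuatZ.nrm_def] using hn
    have h2 : ((0, x.2) : OctZ) ∈ S := by
      refine QuatZ.mem_of_basis (S.comap (AddMonoidHom.inr QuatZ QuatZ)) (fun p hp => ?_) x.2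
      obtain ⟨hn, f, hf⟩ := QuatZ.isHyperbolic_of_mem hp
      refine AddSubgroup.subset_closure ⟨?_, (0, f), (OctZ.trc_inr f p).trans hf⟩
      simpa [OctZ.nrm_def, QuatZ.nrm_def] using hn
    have : x = (x.1, 0) + (0, x.2) := by simp
    rw [this]
    exact add_mem h1 h2
  exists_eq_zsmul d x h := by
    obtain ⟨p, hp⟩ := QuatZ.eq_zsmul_of_trc d x.1 fun w => by
      simpa [OctZ.trc_cmul_conj, QuatZ.conj_def, QuatZ.cmul_def, QuatZ.trc_def] using h (w, 0)
    obtain ⟨q, hq⟩ := QuatZ.eq_zsmul_of_trc d x.2 fun w => by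
      simpa [OctZ.trc_cmul_conj, QuatZ.conj_def, QuatZ.cmul_def, QuatZ.trc_def] using h (0, w)
    exact ⟨(p, q), Prod.ext hp hq⟩

end Instances

open IsSplitComposition

/-! ### Consequences of the composition laws. -/

section Composition

variable {C : Type} [AddCommGroup C] [CompositionOps C] [IsSplitComposition C]

theorem cmul_zsmul (m : ℤ) (x y : C) : cmul x (m • y) = m • cmul x y :=
  (AddMonoidHom.mk' (cmul x) (cmul_add x)).map_zsmul m y

theorem zsmul_cmul (m : ℤ) (x y : C) : cmul (m • x) y = m • cmul x y :=
  (AddMonoidHom.mk' (fun z => cmul z y) (fun a b => add_cmul a b y)).map_zsmul m x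

theorem conj_zsmul (m : ℤ) (x : C) : conj (m • x) = m • conj x :=
  (AddMonoidHom.mk' (conj : C → C) conj_add).map_zsmul m x

theorem trc_zsmul (m : ℤ) (x : C) : trc (m • x) = m * trc x :=
  ((AddMonoidHom.mk' (trc : C → ℤ) trc_add).map_zsmul m x).trans (smul_eq_mul _ _)

theorem cmul_neg (x y : C) : cmul x (-y) = -cmul x y :=
  (AddMonoidHom.mk' (cmul x) (cmul_add x)).map_neg y

theorem neg_cmul (x y : C) : cmul (-x) y = -cmul x y :=
  (AddMonoidHom.mk' (fun z => cmul z y) (fun a b => add_cmul a b y)).map_neg x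

theorem conj_neg (x : C) : conj (-x) = -conj x :=
  (AddMonoidHom.mk' (conj : C → C) conj_add).map_neg x

theorem trc_neg (x : C) : trc (-x) = -trc x :=
  (AddMonoidHom.mk' (trc : C → ℤ) trc_add).map_neg x

theorem cmul_sub (x y z : C) : cmul x (y - z) = cmul x y - cmul x z :=
  (AddMonoidHom.mk' (cmul x) (cmul_add x)).map_sub y z

theorem sub_cmul (x y z : C) : cmul (x - y) z = cmul x z - cmul y z :=
  (AddMonoidHom.mk' (fun w => cmul w z) (fun a b => add_cmul a b z)).map_sub x y

theorem conj_sub (x y : C) : conj (x - y) = conj x - conj y :=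
  (AddMonoidHom.mk' (conj : C → C) conj_add).map_sub x y

theorem trc_sub (x y : C) : trc (x - y) = trc x - trc y :=
  (AddMonoidHom.mk' (trc : C → ℤ) trc_add).map_sub x y

theorem cmul_zero (x : C) : cmul x 0 = 0 := (AddMonoidHom.mk' (cmul x) (cmul_add x)).map_zero

theorem zero_cmul (x : C) : cmul 0 x = 0 :=
  (AddMonoidHom.mk' (fun w => cmul w x) (fun a b => add_cmul a b x)).map_zero

@[simp] theorem conj_zero : conj (0 : C) = 0 :=
  (AddMonoidHom.mk' (conj : C → C) conj_add).map_zero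

@[simp] theorem trc_zero : trc (0 : C) = 0 :=
  (AddMonoidHom.mk' (trc : C → ℤ) trc_add).map_zero

@[simp] theorem nrm_zero : nrm (0 : C) = 0 := by
  have := nrm_zsmul (0 : ℤ) (0 : C)
  simpa using this

attribute [simp] cmul_zero zero_cmul conj_conj

theorem nrm_neg (x : C) : nrm (-x) = nrm x := by
  have := nrm_zsmul (-1 : ℤ) x
  simpa using this

theorem nrm_sub (x y : C) : nrm (x - y) = nrm x + nrm y - trc (cmul x (conj y)) := by
  rw [sub_eq_add_neg, nrm_add, nrm_neg, conj_neg, cmul_neg, trc_neg]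
  ring

/-- The trace form is symmetric. -/
theorem trc_symm (x y : C) : trc (cmul x (conj y)) = trc (cmul y (conj x)) := by
  rw [← trc_conj, conj_cmul, conj_conj]

theorem trc_cyc (x y z : C) : trc (cmul (cmul x y) z) = trc (cmul (cmul y z) x) := by
  rw [← trc_assoc, trc_comm]

theorem trc_conj3 (x y z : C) :
    trc (cmul (cmul (conj z) (conj y)) (conj x)) = trc (cmul (cmul x y) z) := by
  rw [← trc_conj, conj_cmul, conj_cmul, conj_conj, conj_conj, conj_conj, trc_assoc]

theorem cmul_cmul_conj (x y : C) : cmul (cmul x y) (conj y) = nrm y • x := by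
  have := conj_cmul_cancel (conj y) (conj x)
  rw [conj_conj] at this
  rw [← conj_conj (cmul (cmul x y) (conj y)), conj_cmul (cmul x y), conj_cmul x, conj_conj, this,
    conj_zsmul, conj_conj, nrm_conj]

theorem cmul_conj_cmul (x y : C) : cmul (cmul x (conj y)) y = nrm y • x := by
  have := cmul_cmul_conj x (conj y)
  rwa [conj_conj, nrm_conj] at this

/-- Divisibility by `d = 0` is vanishing, so unimodularity of the trace form contains its
nondegeneracy. The same device recurs below. -/
theorem eq_zero_of_trc {x : C} (h : ∀ w, trc (cmul x (conj w)) = 0) : x = 0 := by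
  obtain ⟨x', hx⟩ := exists_eq_zsmul 0 x fun w => by rw [h w]
  rw [hx, zero_smul]

/-- Reduces additive statements to null elements, for which the quadratic terms in `nrm` disappear.
-/
theorem hyperbolic_induction {p : C → Prop} (h : ∀ e, IsHyperbolic e → p e) (h0 : p 0)
    (hadd : ∀ x y, p x → p y → p (x + y)) (hneg : ∀ x, p x → p (-x)) (x : C) : p x := by
  have hx : x ∈ AddSubgroup.closure {e : C | IsHyperbolic e} := by
    rw [closure_isHyperbolic]; trivial
  induction hx using AddSubgroup.closure_induction with
  | mem e he => exact h e he
  | zero => exact h0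
  | add x y _ _ hx hy => exact hadd x y hx hy
  | neg x _ hx => exact hneg x hx

theorem exists_eq_zsmul_of_hyperbolic {d : ℤ} {x : C}
    (h : ∀ e, IsHyperbolic e → d ∣ trc (cmul x (conj e))) : ∃ x', x = d • x' := by
  refine exists_eq_zsmul d x fun w => ?_
  induction w using hyperbolic_induction with
  | h e he => exact h e he
  | h0 => simp
  | hadd x y hx hy => rw [conj_add, cmul_add, trc_add]; exact dvd_add hx hy
  | hneg x hx => rw [conj_neg, cmul_neg, trc_neg]; exact (dvd_neg).2 hx

end Composition

/-! ### The cubic norm structure on Hermitian matrices. -/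

namespace H3

section Projections

variable {C : Type} [AddCommGroup C]

@[simp] theorem zero_a : (0 : H3 C).a = 0 := rfl
@[simp] theorem zero_b : (0 : H3 C).b = 0 := rfl
@[simp] theorem zero_c : (0 : H3 C).c = 0 := rfl
@[simp] theorem zero_x : (0 : H3 C).x = 0 := rfl
@[simp] theorem zero_y : (0 : H3 C).y = 0 := rfl
@[simp] theorem zero_z : (0 : H3 C).z = 0 := rfl
@[simp] theorem add_a (A B : H3 C) : (A + B).a = A.a + B.a := rfl
@[simp] theorem add_b (A B : H3 C) : (A + B).b = A.b + B.b := rfl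
@[simp] theorem add_c (A B : H3 C) : (A + B).c = A.c + B.c := rfl
@[simp] theorem add_x (A B : H3 C) : (A + B).x = A.x + B.x := rfl
@[simp] theorem add_y (A B : H3 C) : (A + B).y = A.y + B.y := rfl
@[simp] theorem add_z (A B : H3 C) : (A + B).z = A.z + B.z := rfl
@[simp] theorem sub_a (A B : H3 C) : (A - B).a = A.a - B.a := rfl
@[simp] theorem sub_b (A B : H3 C) : (A - B).b = A.b - B.b := rfl
@[simp] theorem sub_c (A B : H3 C) : (A - B).c = A.c - B.c := rfl
@[simp] theorem sub_x (A B : H3 C) : (A - B).x = A.x - B.x := rfl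
@[simp] theorem sub_y (A B : H3 C) : (A - B).y = A.y - B.y := rfl
@[simp] theorem sub_z (A B : H3 C) : (A - B).z = A.z - B.z := rfl
@[simp] theorem neg_a (A : H3 C) : (-A).a = -A.a := rfl
@[simp] theorem neg_b (A : H3 C) : (-A).b = -A.b := rfl
@[simp] theorem neg_c (A : H3 C) : (-A).c = -A.c := rfl
@[simp] theorem neg_x (A : H3 C) : (-A).x = -A.x := rfl
@[simp] theorem neg_y (A : H3 C) : (-A).y = -A.y := rfl
@[simp] theorem neg_z (A : H3 C) : (-A).z = -A.z := rfl
@[simp] theorem zsmul_a (m : ℤ) (A : H3 C) : (m • A).a = m * A.a := rfl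
@[simp] theorem zsmul_b (m : ℤ) (A : H3 C) : (m • A).b = m * A.b := rfl
@[simp] theorem zsmul_c (m : ℤ) (A : H3 C) : (m • A).c = m * A.c := rfl
@[simp] theorem zsmul_x (m : ℤ) (A : H3 C) : (m • A).x = m • A.x := rfl
@[simp] theorem zsmul_y (m : ℤ) (A : H3 C) : (m • A).y = m • A.y := rfl
@[simp] theorem zsmul_z (m : ℤ) (A : H3 C) : (m • A).z = m • A.z := rfl

end Projections

variable {C : Type} [AddCommGroup C] [CompositionOps C] [IsSplitComposition C]

theorem cross_eq (A B : H3 C) : cross A B =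
    ⟨A.b * B.c + A.c * B.b - trc (cmul A.x (conj B.x)),
     A.a * B.c + A.c * B.a - trc (cmul A.y (conj B.y)),
     A.a * B.b + A.b * B.a - trc (cmul A.z (conj B.z)),
     cmul (conj A.z) (conj B.y) + cmul (conj B.z) (conj A.y) - A.a • B.x - B.a • A.x,
     cmul (conj A.x) (conj B.z) + cmul (conj B.x) (conj A.z) - A.b • B.y - B.b • A.y,
     cmul (conj A.y) (conj B.x) + cmul (conj B.y) (conj A.x) - A.c • B.z - B.c • A.z⟩ := by
  ext
  · simp only [cross, sharp, sub_a, add_b, add_c, add_x, nrm_add]; ring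
  · simp only [cross, sharp, sub_b, add_a, add_c, add_y, nrm_add]; ring
  · simp only [cross, sharp, sub_c, add_a, add_b, add_z, nrm_add]; ring
  · simp only [cross, sharp, sub_x, add_a, add_x, add_y, add_z, conj_add, add_cmul, cmul_add]
    module
  · simp only [cross, sharp, sub_y, add_b, add_x, add_y, add_z, conj_add, add_cmul, cmul_add]
    module
  · simp only [cross, sharp, sub_z, add_c, add_x, add_y, add_z, conj_add, add_cmul, cmul_add]
    module

theorem sharp_add (A B : H3 C) : sharp (A + B) = sharp A + sharp B + cross A B := by
  rw [cross]; abel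

theorem cross_comm (A B : H3 C) : cross A B = cross B A := by
  rw [cross, cross, add_comm A B]; abel

theorem add_cross (A A' B : H3 C) : cross (A + A') B = cross A B + cross A' B := by
  simp only [cross_eq]
  ext <;> simp only [add_a, add_b, add_c, add_x, add_y, add_z, add_cmul, cmul_add, conj_add,
    trc_add, add_smul, smul_add] <;> first | ring1 | abel

theorem cross_add (A B B' : H3 C) : cross A (B + B') = cross A B + cross A B' := by
  rw [cross_comm, add_cross, cross_comm B, cross_comm B']

theorem zsmul_cross (m : ℤ) (A B : H3 C) : cross (m • A) B = m • cross A B :=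
  (AddMonoidHom.mk' (fun D => cross D B) (fun D D' => add_cross D D' B)).map_zsmul m A

theorem cross_zsmul (m : ℤ) (A B : H3 C) : cross A (m • B) = m • cross A B := by
  rw [cross_comm, zsmul_cross, cross_comm]

theorem neg_cross (A B : H3 C) : cross (-A) B = -cross A B :=
  (AddMonoidHom.mk' (fun D => cross D B) (fun D D' => add_cross D D' B)).map_neg A

theorem cross_neg (A B : H3 C) : cross A (-B) = -cross A B := by
  rw [cross_comm, neg_cross, cross_comm]

@[simp] theorem zero_cross (B : H3 C) : cross 0 B = 0 :=
  (AddMonoidHom.mk' (fun D => cross D B) (fun D D' => add_cross D D' B)).map_zero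

@[simp] theorem cross_zero (B : H3 C) : cross B 0 = 0 := by rw [cross_comm, zero_cross]

theorem sharp_zsmul (m : ℤ) (A : H3 C) : sharp (m • A) = m ^ 2 • sharp A := by
  ext <;> simp only [sharp, zsmul_a, zsmul_b, zsmul_c, zsmul_x, zsmul_y, zsmul_z, nrm_zsmul,
    conj_zsmul, cmul_zsmul, zsmul_cmul, smul_sub, smul_smul] <;> first | ring1 | skip
  all_goals congr 2 <;> ring

theorem sharp_neg (A : H3 C) : sharp (-A) = sharp A := by
  have := sharp_zsmul (-1) A
  rw [neg_one_zsmul] at this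
  rw [this]; simp

@[simp] theorem sharp_zero : sharp (0 : H3 C) = 0 := by
  have := sharp_zsmul 0 (0 : H3 C)
  rw [zero_smul] at this
  rw [this]; simp

theorem cross_self (A : H3 C) : cross A A = 2 • sharp A := by
  have h := sharp_zsmul 2 A
  rw [two_zsmul, sharp_add] at h
  have : cross A A = (2 : ℤ) ^ 2 • sharp A - sharp A - sharp A := by rw [← h]; abel
  rw [this]; module

theorem add_bil (A A' B : H3 C) : bil (A + A') B = bil A B + bil A' B := by
  simp only [bil, add_a, add_b, add_c, add_x, add_y, add_z, add_cmul, trc_add]; ring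

theorem bil_comm (A B : H3 C) : bil A B = bil B A := by
  simp only [bil, trc_symm A.x, trc_symm A.y, trc_symm A.z]; ring

theorem bil_add (A B B' : H3 C) : bil A (B + B') = bil A B + bil A B' := by
  rw [bil_comm, add_bil, bil_comm B, bil_comm B']

theorem zsmul_bil (m : ℤ) (A B : H3 C) : bil (m • A) B = m * bil A B := by
  simp only [bil, zsmul_a, zsmul_b, zsmul_c, zsmul_x, zsmul_y, zsmul_z, zsmul_cmul, trc_zsmul]
  ring

theorem bil_zsmul (m : ℤ) (A B : H3 C) : bil A (m • B) = m * bil A B := by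
  rw [bil_comm, zsmul_bil, bil_comm]

theorem neg_bil (A B : H3 C) : bil (-A) B = -bil A B :=
  (AddMonoidHom.mk' (fun D => bil D B) (fun D D' => add_bil D D' B)).map_neg A

theorem bil_neg (A B : H3 C) : bil A (-B) = -bil A B := by rw [bil_comm, neg_bil, bil_comm]

theorem sub_bil (A A' B : H3 C) : bil (A - A') B = bil A B - bil A' B := by
  rw [sub_eq_add_neg, add_bil, neg_bil, sub_eq_add_neg]

@[simp] theorem zero_bil (B : H3 C) : bil 0 B = 0 := by
  simpa using zsmul_bil 0 0 B

@[simp] theorem bil_zero (B : H3 C) : bil B 0 = 0 := by rw [bil_comm, zero_bil]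

theorem N_zsmul (m : ℤ) (A : H3 C) : N (m • A) = m ^ 3 * N A := by
  simp only [N, zsmul_a, zsmul_b, zsmul_c, zsmul_x, zsmul_y, zsmul_z, nrm_zsmul,
    cmul_zsmul, zsmul_cmul, trc_zsmul]
  ring

theorem N_neg (A : H3 C) : N (-A) = -N A := by
  have := N_zsmul (-1) A
  rw [neg_one_zsmul] at this
  rw [this]; ring

@[simp] theorem N_zero : N (0 : H3 C) = 0 := by
  simpa using N_zsmul 0 (0 : H3 C)

theorem bil_sharp (A B : H3 C) : bil (sharp A) B =
    (A.b * A.c - nrm A.x) * B.a + (A.a * A.c - nrm A.y) * B.b + (A.a * A.b - nrm A.z) * B.c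
    + trc (cmul (cmul B.x A.y) A.z) + trc (cmul (cmul A.x B.y) A.z)
    + trc (cmul (cmul A.x A.y) B.z) - A.a * trc (cmul A.x (conj B.x))
    - A.b * trc (cmul A.y (conj B.y)) - A.c * trc (cmul A.z (conj B.z)) := by
  simp only [bil, sharp, sub_cmul, trc_sub, zsmul_cmul, trc_zsmul, trc_conj3]
  rw [trc_cyc A.x B.y, trc_cyc B.z, trc_cyc A.x A.y B.z]
  rw [trc_cyc A.y B.z]
  ring

theorem N_add (A B : H3 C) : N (A + B) = N A + bil (sharp A) B + bil A (sharp B) + N B := by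
  rw [bil_comm A, bil_sharp, bil_sharp, trc_symm B.x, trc_symm B.y, trc_symm B.z]
  simp only [N, add_a, add_b, add_c, add_x, add_y, add_z, nrm_add, add_cmul, cmul_add, trc_add]
  ring

/-- Both sides are the full polarization of `N`: expand `N(A + B + D)` with the two bracketings and
compare. -/
theorem bil_cross (A B D : H3 C) : bil (cross A B) D = bil A (cross B D) := by
  have h1 := N_add (A + B) D
  have h2 := N_add A (B + D)
  rw [← add_assoc, h1, sharp_add, sharp_add, N_add, N_add B D] at h2
  simp only [add_bil, bil_add] at h2
  linarith

theorem bil_sharp_self (A : H3 C) : bil (sharp A) A = 3 * N A := by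
  have h := N_zsmul 2 A
  rw [two_zsmul, N_add, bil_comm A] at h
  linarith

/-- One diagonal and one off-diagonal entry suffice, since cyclic permutation of the indices gives
the others. The off-diagonal entry rests on the Moufang-type law. -/
theorem sharp_sharp (A : H3 C) : sharp (sharp A) = N A • A := by
  have key : ∀ a b c : ℤ, ∀ x y z : C,
      cmul (conj (cmul (conj y) (conj x) - c • z)) (conj (cmul (conj x) (conj z) - b • y))
        - (b * c - nrm x) • (cmul (conj z) (conj y) - a • x) =
      (a * b * c - a * nrm x - b * nrm y - c * nrm z + trc (cmul (cmul x y) z)) • x := by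
    intro a b c x y z
    simp only [conj_sub, conj_cmul, conj_conj, conj_zsmul, sub_cmul, cmul_sub, zsmul_cmul,
      cmul_zsmul, moufang, conj_cmul_cancel, cmul_cmul_conj]
    module
  have key2 : ∀ a b c : ℤ, ∀ x y z : C,
      (a * c - nrm y) * (a * b - nrm z) - nrm (cmul (conj z) (conj y) - a • x) =
      (a * b * c - a * nrm x - b * nrm y - c * nrm z + trc (cmul (cmul x y) z)) * a := by
    intro a b c x y z
    rw [nrm_sub, nrm_cmul, nrm_conj, nrm_conj, nrm_zsmul, conj_zsmul, cmul_zsmul, trc_zsmul,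
      trc_conj3]
    ring
  have hN : ∀ a b c : ℤ, ∀ x y z : C,
      a * b * c - a * nrm x - b * nrm y - c * nrm z + trc (cmul (cmul x y) z) =
      b * c * a - b * nrm y - c * nrm z - a * nrm x + trc (cmul (cmul y z) x) := by
    intro a b c x y z
    rw [trc_cyc]; ring
  ext
  · exact key2 _ _ _ _ _ _
  · simp only [sharp, N, zsmul_b]
    rw [hN, ← key2 A.b A.c A.a]; ring
  · simp only [sharp, N, zsmul_c]
    rw [hN, hN, ← key2 A.c A.a A.b]; ring
  · exact key _ _ _ _ _ _
  · simp only [sharp, N, zsmul_y]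
    rw [hN, ← key A.b A.c A.a, mul_comm A.c A.a]
  · simp only [sharp, N, zsmul_z]
    rw [hN, hN, ← key A.c A.a A.b]

/-- The module is torsion-free because the trace form on `C` is nondegenerate with values in `ℤ`. -/
theorem zsmul_left_cancel {m : ℤ} (hm : m ≠ 0) {A B : H3 C} (h : m • A = m • B) : A = B := by
  have hC : ∀ x y : C, m • x = m • y → x = y := by
    intro x y hxy
    have h0 : x - y = 0 := eq_zero_of_trc fun w => by
      have : m * trc (cmul (x - y) (conj w)) = 0 := by
        rw [← trc_zsmul, ← zsmul_cmul, smul_sub, hxy, sub_self, zero_cmul, trc_zero]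
      exact (mul_eq_zero.1 this).resolve_left hm
    exact sub_eq_zero.1 h0
  ext
  · exact mul_left_cancel₀ hm (congrArg H3.a h)
  · exact mul_left_cancel₀ hm (congrArg H3.b h)
  · exact mul_left_cancel₀ hm (congrArg H3.c h)
  · exact hC _ _ (congrArg H3.x h)
  · exact hC _ _ (congrArg H3.y h)
  · exact hC _ _ (congrArg H3.z h)

/-- The linearized adjoint identity for an element `E` with `E^# = 0`, `N(E) = 0`. -/
theorem cross_cross_add_sharp_cross (A E : H3 C) (hE : sharp E = 0) (hN : N E = 0) :
    cross (sharp A) (cross A E) + sharp (cross A E) =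
      N A • E + bil (sharp A) E • A + bil (sharp A) E • E := by
  have h := sharp_sharp (A + E)
  rw [sharp_add, hE, add_zero, N_add, hE, hN, bil_zero, add_zero, add_zero, sharp_add,
    sharp_sharp, add_smul, smul_add, smul_add, add_assoc, add_assoc, add_right_inj] at h
  rw [add_comm (sharp _)] at h
  rw [h]; abel

/-- The part of the linearized adjoint identity that is odd in `E`, isolated by comparison with
`-E`; the even part is `sharp_cross`. -/
theorem cross_sharp_cross (A E : H3 C) (hE : sharp E = 0) (hN : N E = 0) :
    cross (sharp A) (cross A E) = N A • E + bil (sharp A) E • A := by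
  have h1 := cross_cross_add_sharp_cross A E hE hN
  have h2 := cross_cross_add_sharp_cross A (-E) (by rw [sharp_neg, hE]) (by rw [N_neg, hN, neg_zero])
  simp only [cross_neg, sharp_neg, bil_neg] at h2
  have h3 : (2 : ℤ) • cross (sharp A) (cross A E) = (2 : ℤ) • (N A • E + bil (sharp A) E • A) := by
    have : (2 : ℤ) • cross (sharp A) (cross A E) =
      (cross (sharp A) (cross A E) + sharp (cross A E)) -
      (-cross (sharp A) (cross A E) + sharp (cross A E)) := by module
    rw [this, h1, h2]; module
  exact zsmul_left_cancel two_ne_zero h3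

theorem sharp_cross (A E : H3 C) (hE : sharp E = 0) (hN : N E = 0) :
    sharp (cross A E) = bil (sharp A) E • E := by
  have h1 := cross_cross_add_sharp_cross A E hE hN
  rw [cross_sharp_cross A E hE hN] at h1
  exact add_left_cancel h1

end H3

/-! ### Rank-one elements and norm-preserving maps. -/

namespace H3

section RankOne

variable {C : Type} [AddCommGroup C] [CompositionOps C] [IsSplitComposition C]

/-- Unimodular elements of rank one. -/
def IsRankOne (E : H3 C) : Prop := sharp E = 0 ∧ N E = 0 ∧ ∃ D, bil D E = 1

theorem isRankOne_a : IsRankOne (⟨1, 0, 0, 0, 0, 0⟩ : H3 C) :=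
  ⟨by ext <;> simp [sharp], by simp [N], ⟨1, 0, 0, 0, 0, 0⟩, by simp [bil]⟩

theorem isRankOne_b : IsRankOne (⟨0, 1, 0, 0, 0, 0⟩ : H3 C) :=
  ⟨by ext <;> simp [sharp], by simp [N], ⟨0, 1, 0, 0, 0, 0⟩, by simp [bil]⟩

theorem isRankOne_c : IsRankOne (⟨0, 0, 1, 0, 0, 0⟩ : H3 C) :=
  ⟨by ext <;> simp [sharp], by simp [N], ⟨0, 0, 1, 0, 0, 0⟩, by simp [bil]⟩

theorem isRankOne_x {e : C} (he : IsHyperbolic e) : IsRankOne (⟨0, 0, 0, e, 0, 0⟩ : H3 C) := by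
  obtain ⟨h0, f, hf⟩ := he
  exact ⟨by ext <;> simp [sharp, h0], by simp [N], ⟨0, 0, 0, f, 0, 0⟩, by simp [bil, hf]⟩

theorem isRankOne_y {e : C} (he : IsHyperbolic e) : IsRankOne (⟨0, 0, 0, 0, e, 0⟩ : H3 C) := by
  obtain ⟨h0, f, hf⟩ := he
  exact ⟨by ext <;> simp [sharp, h0], by simp [N], ⟨0, 0, 0, 0, f, 0⟩, by simp [bil, hf]⟩

theorem isRankOne_z {e : C} (he : IsHyperbolic e) : IsRankOne (⟨0, 0, 0, 0, 0, e⟩ : H3 C) := by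
  obtain ⟨h0, f, hf⟩ := he
  exact ⟨by ext <;> simp [sharp, h0], by simp [N], ⟨0, 0, 0, 0, 0, f⟩, by simp [bil, hf]⟩

theorem closure_isRankOne : AddSubgroup.closure {E : H3 C | IsRankOne E} = ⊤ := by
  refine eq_top_iff.2 fun A _ => ?_
  set S := AddSubgroup.closure {E : H3 C | IsRankOne E}
  have hx : (⟨0, 0, 0, A.x, 0, 0⟩ : H3 C) ∈ S := by
    generalize A.x = w
    induction w using hyperbolic_induction with
    | h e he => exact AddSubgroup.subset_closure (isRankOne_x he)
    | h0 => exact zero_mem S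
    | hadd x y hx hy => convert add_mem hx hy using 1; ext <;> simp
    | hneg x hx => convert neg_mem hx using 1; ext <;> simp
  have hy : (⟨0, 0, 0, 0, A.y, 0⟩ : H3 C) ∈ S := by
    generalize A.y = w
    induction w using hyperbolic_induction with
    | h e he => exact AddSubgroup.subset_closure (isRankOne_y he)
    | h0 => exact zero_mem S
    | hadd x y hx hy => convert add_mem hx hy using 1; ext <;> simp
    | hneg x hx => convert neg_mem hx using 1; ext <;> simp
  have hz : (⟨0, 0, 0, 0, 0, A.z⟩ : H3 C) ∈ S := by
    generalize A.z = w
    induction w using hyperbolic_induction with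
    | h e he => exact AddSubgroup.subset_closure (isRankOne_z he)
    | h0 => exact zero_mem S
    | hadd x y hx hy => convert add_mem hx hy using 1; ext <;> simp
    | hneg x hx => convert neg_mem hx using 1; ext <;> simp
  have ha : A.a • (⟨1, 0, 0, 0, 0, 0⟩ : H3 C) ∈ S :=
    S.zsmul_mem (AddSubgroup.subset_closure isRankOne_a) _
  have hb : A.b • (⟨0, 1, 0, 0, 0, 0⟩ : H3 C) ∈ S :=
    S.zsmul_mem (AddSubgroup.subset_closure isRankOne_b) _
  have hc : A.c • (⟨0, 0, 1, 0, 0, 0⟩ : H3 C) ∈ S :=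
    S.zsmul_mem (AddSubgroup.subset_closure isRankOne_c) _
  convert add_mem (add_mem (add_mem ha hb) (add_mem hc hx)) (add_mem hy hz) using 1
  ext <;> simp

theorem exists_eq_zsmul_of_bil {d : ℤ} {A : H3 C} (h : ∀ E, IsRankOne E → d ∣ bil A E) :
    ∃ A', A = d • A' := by
  obtain ⟨a, ha⟩ := h _ isRankOne_a
  obtain ⟨b, hb⟩ := h _ isRankOne_b
  obtain ⟨c, hc⟩ := h _ isRankOne_c
  obtain ⟨x, hx⟩ : ∃ x, A.x = d • x := exists_eq_zsmul_of_hyperbolic fun e he => by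
    simpa [bil] using h _ (isRankOne_x he)
  obtain ⟨y, hy⟩ : ∃ y, A.y = d • y := exists_eq_zsmul_of_hyperbolic fun e he => by
    simpa [bil] using h _ (isRankOne_y he)
  obtain ⟨z, hz⟩ : ∃ z, A.z = d • z := exists_eq_zsmul_of_hyperbolic fun e he => by
    simpa [bil] using h _ (isRankOne_z he)
  simp [bil] at ha hb hc
  exact ⟨⟨a, b, c, x, y, z⟩, by ext <;> simpa⟩

theorem eq_zero_of_bil {A : H3 C} (h : ∀ E, bil A E = 0) : A = 0 := by
  obtain ⟨A', hA⟩ := exists_eq_zsmul_of_bil (d := 0) (A := A) fun E _ => by rw [h E]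
  rw [hA, zero_smul]

theorem ext_bil {A B : H3 C} (h : ∀ E, bil A E = bil B E) : A = B :=
  sub_eq_zero.1 (eq_zero_of_bil fun E => by rw [sub_bil, h, sub_self])

/-- By `bil_cross`, `d` divides `(A, E × F)` for rank-one `E`. Products of the diagonal idempotents
with a second idempotent or a hyperbolic off-diagonal element are enough to detect every entry of
`A`. -/
theorem exists_eq_zsmul_of_cross {d : ℤ} {A : H3 C}
    (h : ∀ E, IsRankOne E → ∃ A', cross A E = d • A') : ∃ A', A = d • A' := by
  have key : ∀ E F : H3 C, IsRankOne E → d ∣ bil A (cross E F) := by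
    intro E F hE
    obtain ⟨A', hA⟩ := h E hE
    rw [← bil_cross, hA, zsmul_bil]
    exact dvd_mul_right _ _
  have ha : d ∣ A.a := by
    simpa [bil, cross_eq] using key _ ⟨0, 0, 1, 0, 0, 0⟩ isRankOne_b
  have hb : d ∣ A.b := by
    simpa [bil, cross_eq] using key _ ⟨1, 0, 0, 0, 0, 0⟩ isRankOne_c
  have hc : d ∣ A.c := by
    simpa [bil, cross_eq] using key _ ⟨0, 1, 0, 0, 0, 0⟩ isRankOne_a
  obtain ⟨x, hx⟩ : ∃ x, A.x = d • x := exists_eq_zsmul_of_hyperbolic fun e he => by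
    simpa [bil, cross_eq, conj_neg, cmul_neg, trc_neg] using key _ ⟨0, 0, 0, e, 0, 0⟩ isRankOne_a
  obtain ⟨y, hy⟩ : ∃ y, A.y = d • y := exists_eq_zsmul_of_hyperbolic fun e he => by
    simpa [bil, cross_eq, conj_neg, cmul_neg, trc_neg] using key _ ⟨0, 0, 0, 0, e, 0⟩ isRankOne_b
  obtain ⟨z, hz⟩ : ∃ z, A.z = d • z := exists_eq_zsmul_of_hyperbolic fun e he => by
    simpa [bil, cross_eq, conj_neg, cmul_neg, trc_neg] using key _ ⟨0, 0, 0, 0, 0, e⟩ isRankOne_c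
  obtain ⟨a, ha⟩ := ha
  obtain ⟨b, hb⟩ := hb
  obtain ⟨c, hc⟩ := hc
  exact ⟨⟨a, b, c, x, y, z⟩, by ext <;> simpa⟩

/-! ### Adjoints of norm-preserving maps -/

variable {s s' : H3 C ≃ₗ[ℤ] H3 C}

theorem bil_map_symm (hs' : IsAdjoint s s') (A B : H3 C) :
    bil (s A) (s'.symm B) = bil A B := by
  rw [hs', LinearEquiv.apply_symm_apply]

theorem bil_sharp_map (hs : IsNormPreserving s) (A B : H3 C) :
    bil (sharp (s A)) (s B) = bil (sharp A) B := by
  -- The difference of the expansions at `B` and `-B` keeps `(A^#, B) + N(B)`, and `N(B)` is already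
  -- invariant.
  have h1 := hs (A + B)
  have h2 := hs (A - B)
  rw [map_add, N_add, N_add, hs, hs] at h1
  rw [map_sub, sub_eq_add_neg, sub_eq_add_neg, N_add, N_add, N_neg, N_neg, hs, hs, sharp_neg,
    sharp_neg, bil_neg, bil_neg] at h2
  linarith

theorem sharp_map (hs : IsNormPreserving s) (hs' : IsAdjoint s s') (A : H3 C) :
    sharp (s A) = s'.symm (sharp A) := by
  rw [LinearEquiv.eq_symm_apply]
  refine ext_bil fun E => ?_
  rw [bil_comm, ← hs', bil_comm, bil_sharp_map hs]

/-- Write `N(B) B = B^##`, so that `N(B) s^*⁻¹(B) = (s(B^#))^#`. A further sharp gives the claim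
multiplied by `N(B)²`, which can be cancelled. -/
theorem sharp_symm_of_N_ne_zero (hs : IsNormPreserving s) (hs' : IsAdjoint s s') {B : H3 C}
    (hB : N B ≠ 0) : sharp (s'.symm B) = s (sharp B) := by
  have h1 : N B • s'.symm B = sharp (s (sharp B)) := by
    rw [sharp_map hs hs', sharp_sharp, map_zsmul]
  have h2 : N (sharp B) = N B ^ 2 := by
    have h := sharp_sharp (sharp B)
    rw [sharp_sharp B, sharp_zsmul] at h
    have h3 := congrArg (fun D => bil D B) h
    simp only [zsmul_bil, bil_sharp_self] at h3
    have : N B * (N (sharp B) - N B ^ 2) = 0 := by linarith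
    have := (mul_eq_zero.1 this).resolve_left hB
    linarith
  have h3 := congrArg sharp h1
  rw [sharp_sharp, sharp_zsmul, hs, h2] at h3
  exact zsmul_left_cancel (pow_ne_zero 2 hB) h3

theorem exists_N_add_ne_zero (B : H3 C) : ∃ T : ℤ, ∀ t ≥ T, N (B + t • diag 1 1 1) ≠ 0 := by
  set p := bil (sharp B) (diag 1 1 1) with hp
  set r := bil B (sharp (diag 1 1 1)) with hr
  refine ⟨1 + |p| + |r| + |N B|, fun t ht => ?_⟩
  have h1 : N (diag 1 1 1 : H3 C) = 1 := by simp [N, diag]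
  rw [N_add, sharp_zsmul, N_zsmul, bil_zsmul, bil_zsmul, ← hp, ← hr, h1]
  have a1 := neg_abs_le p
  have a2 := neg_abs_le r
  have a3 := neg_abs_le (N B)
  have b1 := abs_nonneg p
  have b2 := abs_nonneg r
  have b3 := abs_nonneg (N B)
  have ht1 : 1 ≤ t := by linarith
  have ht2 : t ≤ t ^ 2 := by nlinarith
  have e1 : -(t ^ 2 * |p|) ≤ t * p := by nlinarith
  have e2 : -(t ^ 2 * |r|) ≤ t ^ 2 * r := by nlinarith
  have e3 : -(t ^ 2 * |N B|) ≤ N B := by nlinarith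
  have e4 : t ^ 2 * (1 + |p| + |r| + |N B|) ≤ t ^ 2 * t := by nlinarith
  have : 0 < N B + t * p + t ^ 2 * r + t ^ 3 * 1 := by nlinarith
  exact this.ne'

/-- A density argument: `N(B + tI)` is a monic cubic in `t`, so the identity holds at `B + tI` for
all large `t`. It is quadratic in `t`, so three consecutive values kill all its coefficients,
including the constant one. -/
theorem sharp_symm (hs : IsNormPreserving s) (hs' : IsAdjoint s s') (B : H3 C) :
    sharp (s'.symm B) = s (sharp B) := by
  obtain ⟨T, hT⟩ := exists_N_add_ne_zero B
  refine ext_bil fun E => ?_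
  set I : H3 C := diag 1 1 1
  have key : ∀ t ≥ T, bil (sharp (s'.symm B)) E - bil (s (sharp B)) E +
      t * (bil (cross (s'.symm B) (s'.symm I)) E - bil (s (cross B I)) E) +
      t ^ 2 * (bil (sharp (s'.symm I)) E - bil (s (sharp I)) E) = 0 := by
    intro t ht
    have h := congrArg (fun D => bil D E) (sharp_symm_of_N_ne_zero hs hs' (hT t ht))
    simp only [map_add, map_zsmul, sharp_add, sharp_zsmul, cross_zsmul, add_bil, zsmul_bil] at h
    linarith
  have k0 := key T le_rfl
  have k1 := key (T + 1) (by linarith)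
  have k2 := key (T + 2) (by linarith)
  set f0 := bil (sharp (s'.symm B)) E - bil (s (sharp B)) E with hf0
  set f1 := bil (cross (s'.symm B) (s'.symm I)) E - bil (s (cross B I)) E
  set f2 := bil (sharp (s'.symm I)) E - bil (s (sharp I)) E
  have h2 : f2 = 0 := by linarith
  rw [h2] at k0 k1
  have h1 : f1 = 0 := by linarith
  rw [h1] at k0
  have h0 : f0 = 0 := by linarith
  linarith

theorem N_symm (hs : IsNormPreserving s) (hs' : IsAdjoint s s') (B : H3 C) :
    N (s'.symm B) = N B := by
  have h := bil_sharp_self (s'.symm B)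
  rw [sharp_symm hs hs', bil_map_symm hs', bil_sharp_self] at h
  linarith

end RankOne

end H3

/-! ### Invariance of the forms under elementary transformations. -/

namespace M

open H3

section Projections

variable {J : Type} [AddCommGroup J]

@[simp] theorem add_α (u v : M J) : (u + v).α = u.α + v.α := rfl
@[simp] theorem add_β (u v : M J) : (u + v).β = u.β + v.β := rfl
@[simp] theorem add_A (u v : M J) : (u + v).A = u.A + v.A := rfl
@[simp] theorem add_B (u v : M J) : (u + v).B = u.B + v.B := rfl

end Projections

variable {C : Type} [AddCommGroup C] [CompositionOps C] [IsSplitComposition C]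

/-- Preservation of the forms `q'` and `{·, ·}`. -/
def PreservesForms (f : M (H3 C) → M (H3 C)) : Prop :=
  (∀ u v, symp (f u) (f v) = symp u v) ∧ ∀ u, q' (f u) = q' u

theorem PreservesForms.comp {f g : M (H3 C) → M (H3 C)} (hf : PreservesForms f)
    (hg : PreservesForms g) : PreservesForms (fun u => f (g u)) :=
  ⟨fun u v => by rw [hf.1, hg.1], fun u => by rw [hf.2, hg.2]⟩

theorem PreservesForms.of_comp_eq {f g : M (H3 C) → M (H3 C)} (hf : PreservesForms f)
    (h : PreservesForms fun u => f (g u)) : PreservesForms g :=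
  ⟨fun u v => by rw [← hf.1, h.1 u v], fun u => by rw [← hf.2, h.2 u]⟩

theorem phi_add (D E : H3 C) (u : M (H3 C)) : phi (D + E) u = phi D (phi E u) := by
  ext1
  · simp only [phi, bil_add, add_bil, sharp_add, N_add, zsmul_bil, bil_cross u.A E D,
      cross_comm E D, bil_comm D (sharp E), bil_comm E (sharp D)]
    ring
  · rfl
  · simp only [phi]; module
  · simp only [phi, cross_add, add_cross, zsmul_cross, sharp_add, cross_comm E D]; module

theorem phi_zero (u : M (H3 C)) : phi 0 u = u := by
  ext1 <;> simp [phi]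

/-- Here `E × E = 2E^# = 0`, so only the terms of `φ(E)` linear in `E` survive. The mixed terms of
`q'` are evaluated by `cross_sharp_cross` and `sharp_cross`. -/
theorem preservesForms_phi_of_sharp_eq_zero {E : H3 C} (hE : sharp E = 0) (hN : N E = 0) :
    PreservesForms (phi E) := by
  have hEE : cross E E = 0 := by rw [H3.cross_self, hE, smul_zero]
  constructor
  · intro u v
    have h1 : bil E (cross v.A E) = 0 := by rw [bil_comm, bil_cross, hEE, bil_zero]
    have h2 : bil (cross u.A E) E = 0 := by rw [bil_cross, hEE, bil_zero]
    have h3 : bil u.A (cross v.A E) = bil (cross u.A E) v.A := by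
      rw [bil_cross, cross_comm E]
    simp only [symp, phi, hE, hN, bil_zero, smul_zero, add_zero, mul_zero, add_bil, bil_add,
      zsmul_bil, bil_zsmul, h1, h2, h3, bil_comm E]
    ring
  · intro u
    obtain ⟨α, β, A, B⟩ := u
    have h1 : bil (cross A E) E = 0 := by rw [bil_cross, hEE, bil_zero]
    have h2 : bil E (cross A E) = 0 := by rw [bil_comm, h1]
    have h3 : bil A (cross A E) = 2 * bil (sharp A) E := by
      rw [← bil_cross, H3.cross_self, two_nsmul, add_bil]; ring
    have h4 : bil (sharp A) (cross B (cross A E)) = N A * bil B E + bil (sharp A) E * bil A B := by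
      rw [cross_comm, ← bil_cross, cross_sharp_cross A E hE hN, add_bil, zsmul_bil, zsmul_bil,
        bil_comm E]
    have h5 : bil (cross A E) (cross B (cross A E)) = 2 * (bil (sharp A) E * bil B E) := by
      rw [cross_comm B, ← bil_cross, H3.cross_self, sharp_cross A E hE hN, two_nsmul, add_bil, zsmul_bil,
        bil_comm E]
      ring
    have h6 : bil (sharp A) E = bil E (sharp A) := bil_comm _ _
    simp only [q', phi, hE, hN, bil_zero, smul_zero, add_zero, mul_zero]
    rw [sharp_add, sharp_zsmul, hE, cross_zsmul, sharp_add, sharp_cross A E hE hN, N_add, N_add,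
      sharp_zsmul, N_zsmul, hE, hN, sharp_cross A E hE hN]
    -- `(A × E)^#` is a multiple of `E`, and `E` is orthogonal to `A × E`.
    have h7 : N (cross A E) = 0 := by
      have := bil_sharp_self (cross A E)
      rw [sharp_cross A E hE hN, zsmul_bil, h2] at this
      linarith
    rw [h7]
    simp only [bil_add, add_bil, bil_zsmul, zsmul_bil, smul_zero, bil_zero, add_zero, mul_zero,
      h1, h2, h3, h4, h5, bil_comm E B, bil_comm (cross A E) (sharp B)]
    ring

theorem phi_map_add (D : H3 C) (u v : M (H3 C)) : phi D (u + v) = phi D u + phi D v := by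
  ext1
  · simp only [phi, add_α, add_β, add_A, add_B, add_bil]; ring
  · rfl
  · simp only [phi, add_β, add_A]; module
  · simp only [phi, add_β, add_A, add_B, add_cross]; module

/-- `D ↦ φ(D)` turns sums into compositions, so additive generation by rank-one elements reduces the
claim to them. -/
theorem preservesForms_phi (D : H3 C) : PreservesForms (phi D) := by
  have hD : D ∈ AddSubgroup.closure {E : H3 C | IsRankOne E} := by
    rw [closure_isRankOne]; trivial
  induction hD using AddSubgroup.closure_induction with
  | mem E hE => exact preservesForms_phi_of_sharp_eq_zero hE.1 hE.2.1
  | zero => exact preservesForms_phi_of_sharp_eq_zero sharp_zero N_zero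
  | add D E _ _ hD hE =>
    convert hD.comp hE using 1
    exact funext (phi_add D E)
  | neg D _ hD =>
    refine hD.of_comp_eq ?_
    simp only [← phi_add, add_neg_cancel, phi_zero]
    exact ⟨fun _ _ => rfl, fun _ => rfl⟩

theorem preservesForms_tau : PreservesForms (tau : M (H3 C) → M (H3 C)) := by
  constructor
  · intro u v
    simp only [symp, tau, neg_bil, bil_comm u.B, bil_comm u.A]
    ring
  · intro u
    simp only [q', tau, sharp_neg, N_neg, neg_bil, bil_comm u.B, bil_comm (sharp u.B)]
    ring

theorem tau_map_add (u v : M (H3 C)) : tau (u + v) = tau u + tau v := by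
  ext1
  · simp only [tau, add_α, add_β]; ring
  · rfl
  · simp only [tau, add_A, add_B]; abel
  · rfl

theorem tau_psi (D : H3 C) (u : M (H3 C)) : tau (psi D u) = phi (-D) (tau u) := by
  ext1
  · simp only [tau, psi, phi, bil_neg, neg_bil, sharp_neg, N_neg]; ring
  · rfl
  · simp only [tau, psi, phi]; module
  · simp only [tau, psi, phi, sharp_neg, H3.neg_cross, cross_neg, neg_neg]

theorem preservesForms_psi (D : H3 C) : PreservesForms (psi D) := by
  refine preservesForms_tau.of_comp_eq ?_
  simp only [tau_psi]
  exact (preservesForms_phi (-D)).comp preservesForms_tau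

theorem psi_map_add (D : H3 C) (u v : M (H3 C)) : psi D (u + v) = psi D u + psi D v := by
  ext1
  · rfl
  · simp only [psi, add_α, add_β, add_A, add_B, add_bil]; ring
  · simp only [psi, add_α, add_A, add_B, add_cross]; module
  · simp only [psi, add_α, add_B]; module

theorem preservesForms_tf {s s' : H3 C ≃ₗ[ℤ] H3 C} (hs : IsNormPreserving s)
    (hs' : IsAdjoint s s') : PreservesForms (tf s s') := by
  constructor
  · intro u v
    simp only [symp, tf, bil_map_symm hs', bil_comm (s'.symm u.B), bil_comm u.B]
  · intro u
    simp only [q', tf, sharp_symm hs hs', sharp_map hs hs', N_symm hs hs', hs u.A,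
      bil_map_symm hs', bil_comm (s'.symm _) (s _), bil_comm (sharp u.B)]

theorem tf_map_add (s s' : H3 C ≃ₗ[ℤ] H3 C) (u v : M (H3 C)) :
    tf s s' (u + v) = tf s s' u + tf s s' v := by
  ext1 <;> simp [tf]

/-- Elements related by an elementary transformation correspond under an additive map that
preserves the forms. -/
theorem ElementaryStep.exists_map {u v : M (H3 C)} (h : ElementaryStep u v) :
    ∃ f : M (H3 C) → M (H3 C), (∀ u v, f (u + v) = f u + f v) ∧ PreservesForms f ∧ f u = v := by
  cases h with
  | phi D u => exact ⟨_, phi_map_add D, preservesForms_phi D, rfl⟩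
  | psi D u => exact ⟨_, psi_map_add D, preservesForms_psi D, rfl⟩
  | tf s s' hs hs' u => exact ⟨_, tf_map_add s s', preservesForms_tf hs hs', rfl⟩
  | tau u => exact ⟨_, tau_map_add, preservesForms_tau, rfl⟩

theorem ElementaryEquiv.exists_map {u v : M (H3 C)} (h : ElementaryEquiv u v) :
    ∃ f : M (H3 C) → M (H3 C), (∀ u v, f (u + v) = f u + f v) ∧ PreservesForms f ∧ f u = v := by
  induction h with
  | refl => exact ⟨id, fun _ _ => rfl, ⟨fun _ _ => rfl, fun _ => rfl⟩, rfl⟩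
  | tail _ hstep ih =>
    obtain ⟨f, hf, hf', rfl⟩ := ih
    obtain ⟨g, hg, hg', rfl⟩ := hstep.exists_map
    exact ⟨fun u => g (f u), fun u v => by simp only [hf, hg], hg'.comp hf', rfl⟩

theorem ElementaryEquiv.q'_eq {u v : M (H3 C)} (h : ElementaryEquiv u v) : q' u = q' v := by
  obtain ⟨f, -, hf, rfl⟩ := h.exists_map
  exact (hf.2 u).symm

/-! ### The obstruction to projectivity -/

/-- The quantity is twelve times the coefficient of `t` in `q'(u + t y)`. -/
def linCoeff (u y : M (H3 C)) : ℤ :=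
  8 * (q' (u + y) - q' (u - y)) - (q' (u + (y + y)) - q' (u - (y + y)))

/-- Degeneracy of `u` modulo `m`: the gradient of `q'` at `u` is proportional to `u`. -/
def IsDegenerate (m : ℤ) (u : M (H3 C)) : Prop :=
  ∃ l : ℤ, ∀ y, 24 * m ∣ linCoeff u y - 48 * l * symp u y

theorem linCoeff_map {f : M (H3 C) → M (H3 C)} (hadd : ∀ u v, f (u + v) = f u + f v)
    (hf : PreservesForms f) (u y : M (H3 C)) : linCoeff (f u) (f y) = linCoeff u y := by
  have hsub : ∀ u v, f (u - v) = f u - f v := fun u v =>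
    (AddMonoidHom.mk' f hadd).map_sub u v
  simp only [linCoeff, ← hadd, ← hsub, hf.2]

/-- Degeneracy is pulled back, by testing `v` only on the vectors `f y`; the map `f` need not be
known to be invertible. -/
theorem ElementaryEquiv.isDegenerate {m : ℤ} {u v : M (H3 C)} (h : ElementaryEquiv u v)
    (hv : IsDegenerate m v) : IsDegenerate m u := by
  obtain ⟨f, hadd, hf, rfl⟩ := h.exists_map
  obtain ⟨l, hl⟩ := hv
  refine ⟨l, fun y => ?_⟩
  rw [← linCoeff_map hadd hf, ← hf.1]
  exact hl (f y)

theorem q_eq (u : M (H3 C)) : q u = -2 * q' u := by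
  simp only [q, q']; ring

theorem IsAutomorphism.isDegenerate {m : ℤ} {g : M (H3 C) ≃ₗ[ℤ] M (H3 C)}
    (hg : IsAutomorphism g) {u : M (H3 C)} (hu : IsDegenerate m u) : IsDegenerate m (g u) := by
  have hf : PreservesForms g := ⟨hg.1, fun u => by have := hg.2 u; rw [q_eq, q_eq] at this; linarith⟩
  obtain ⟨l, hl⟩ := hu
  refine ⟨l, fun y => ?_⟩
  rw [← g.apply_symm_apply y, linCoeff_map (map_add g) hf, hf.1]
  exact hl _

/-- The finite difference removes the terms of degree 0, 2, 3 and 4 in `y`. The factor after 24 is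
half the derivative of `q'`. -/
theorem linCoeff_eq (α β : ℤ) (A : H3 C) (y : M (H3 C)) :
    linCoeff ⟨α, β, A, 0⟩ y = 24 * (y.α * (2 * N A + α * β ^ 2) + y.β * (α ^ 2 * β)
      + 2 * α * bil (sharp A) y.A - α * β * bil A y.B) := by
  obtain ⟨γ, δ, D, E⟩ := y
  have e1 : (⟨α, β, A, 0⟩ : M (H3 C)) + ⟨γ, δ, D, E⟩ = ⟨α + γ, β + δ, A + D, E⟩ := by
    ext1 <;> simp
  have e2 : (⟨α, β, A, 0⟩ : M (H3 C)) - ⟨γ, δ, D, E⟩ =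
      ⟨α - γ, β - δ, A + -D, -E⟩ := by
    ext1
    · rfl
    · rfl
    · exact sub_eq_add_neg A D
    · exact zero_sub E
  have e3 : (⟨γ, δ, D, E⟩ : M (H3 C)) + ⟨γ, δ, D, E⟩ =
      ⟨2 * γ, 2 * δ, (2 : ℤ) • D, (2 : ℤ) • E⟩ := by
    ext1
    · exact (two_mul γ).symm
    · exact (two_mul δ).symm
    · exact (two_zsmul D).symm
    · exact (two_zsmul E).symm
  have e4 : (⟨α, β, A, 0⟩ : M (H3 C)) + ⟨2 * γ, 2 * δ, (2 : ℤ) • D, (2 : ℤ) • E⟩ =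
      ⟨α + 2 * γ, β + 2 * δ, A + (2 : ℤ) • D, (2 : ℤ) • E⟩ := by
    ext1 <;> simp
  have e5 : (⟨α, β, A, 0⟩ : M (H3 C)) - ⟨2 * γ, 2 * δ, (2 : ℤ) • D, (2 : ℤ) • E⟩ =
      ⟨α - 2 * γ, β - 2 * δ, A + -((2 : ℤ) • D), -((2 : ℤ) • E)⟩ := by
    ext1
    · rfl
    · rfl
    · exact sub_eq_add_neg _ _
    · exact zero_sub _
  rw [linCoeff, e3, e1, e2, e4, e5]
  simp only [q', sharp_add, sharp_neg, sharp_zsmul, cross_neg, cross_zsmul, N_add, N_neg, N_zsmul,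
    add_bil, neg_bil, bil_neg, zsmul_bil, bil_zsmul]
  ring

end M

/-! ### Degeneracy at a prime and the descent on `α`. -/

namespace M

open H3

variable {C : Type} [AddCommGroup C] [CompositionOps C] [IsSplitComposition C]

/-- The modulus at which the degeneracy of an element modulo the prime `p` is detected. -/
def modulus (p : ℕ) : ℤ := if p = 2 then 4 else p

theorem modulus_dvd_sq (p : ℕ) : modulus p ∣ (p : ℤ) ^ 2 := by
  unfold modulus
  split_ifs with h
  · subst h; norm_num
  · exact dvd_pow_self _ two_ne_zero

theorem modulus_dvd_two_mul (p : ℕ) : modulus p ∣ 2 * (p : ℤ) := by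
  unfold modulus
  split_ifs with h
  · subst h; norm_num
  · exact dvd_mul_left _ _

theorem exists_modulus_dvd_sub {p : ℕ} {β : ℤ} (h : (p : ℤ) ∣ β) :
    ∃ l, modulus p ∣ β - 2 * l := by
  unfold modulus
  split_ifs with h2
  · subst h2
    obtain ⟨l, rfl⟩ := h
    exact ⟨l, by simp⟩
  · exact ⟨0, by simpa using h⟩

/-- The derivative of a quartic form is cubic in the base point, hence divisible by `p³` here, and
`l = 0` works. -/
theorem isDegenerate_of_dvd (p : ℕ) (α β : ℤ) (A : H3 C) :
    IsDegenerate (modulus p) ⟨p * α, p * β, (p : ℤ) • A, 0⟩ := by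
  refine ⟨0, fun y => ?_⟩
  obtain ⟨k, hk⟩ := modulus_dvd_sq p
  rw [linCoeff_eq]
  simp only [N_zsmul, sharp_zsmul, zsmul_bil]
  refine ⟨k * (p * (y.α * (2 * N A + α * β ^ 2) + y.β * (α ^ 2 * β)
    + 2 * α * bil (sharp A) y.A - α * β * bil A y.B)), ?_⟩
  linear_combination (24 * (p * (y.α * (2 * N A + α * β ^ 2) + y.β * (α ^ 2 * β)
    + 2 * α * bil (sharp A) y.A - α * β * bil A y.B))) * hk

/-- With `β ≡ 2l`, half the derivative and `2l{u, y}` differ by multiples of `2β`, `2N(A)` and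
`2A^#`. These vanish even modulo 4 when `p = 2`. -/
theorem isDegenerate_of_dvd_sharp {p : ℕ} {β : ℤ} {A S : H3 C} (hβ : (p : ℤ) ∣ β)
    (hS : sharp A = (p : ℤ) • S) (hN : (p : ℤ) ∣ N A) :
    IsDegenerate (modulus p) ⟨1, β, A, 0⟩ := by
  obtain ⟨l, hl⟩ := exists_modulus_dvd_sub hβ
  have h2 : ∀ {m : ℤ}, (p : ℤ) ∣ m → modulus p ∣ 2 * m := fun h =>
    (modulus_dvd_two_mul p).trans (mul_dvd_mul_left 2 h)
  refine ⟨l, fun y => ?_⟩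
  rw [linCoeff_eq, mul_comm 24, hS]
  have : modulus p ∣ 2 * N A * y.α + 2 * β * (β * y.α - bil A y.B) +
      (β - 2 * l) * (y.β - β * y.α + bil A y.B) + 2 * (p * bil S y.A) :=
    dvd_add (dvd_add (dvd_add (Dvd.dvd.mul_right (h2 hN) _) (Dvd.dvd.mul_right (h2 hβ) _))
      (Dvd.dvd.mul_right hl _)) (h2 (dvd_mul_right _ _))
  refine (mul_dvd_mul_right this 24).trans (dvd_of_eq ?_)
  simp only [symp, zsmul_bil, zero_bil]
  ring

theorem not_dvd_of_not_isDegenerate {p : ℕ} {β a b c : ℤ}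
    (h : ¬ IsDegenerate (modulus p) (⟨1, β, diag a b c, 0⟩ : M (H3 C))) (hβ : (p : ℤ) ∣ β)
    (hbc : (p : ℤ) ∣ b * c) (hac : (p : ℤ) ∣ a * c) (hab : (p : ℤ) ∣ a * b) : False := by
  have hN : (p : ℤ) ∣ N (diag a b c : H3 C) := by
    have : N (diag a b c : H3 C) = a * (b * c) := by simp [N, diag]; ring
    rw [this]
    exact dvd_mul_of_dvd_right hbc a
  obtain ⟨k, hk⟩ := hbc
  obtain ⟨l, hl⟩ := hac
  obtain ⟨m, hm⟩ := hab
  exact h (isDegenerate_of_dvd_sharp (S := diag k l m) hβ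
    (by ext1 <;> simp [sharp, diag, hk, hl, hm, -natCast_zsmul]) hN)

/-- As `B = 0`, `α` divides all three coefficients of the first, primitive, binary form. -/
theorem alpha_eq_one {u : M (Fin 3 → ℤ)} (hr : IsReducedDiag u) (hp : IsProjectiveDiag u) :
    u.α = 1 := by
  obtain ⟨h0, hβ, hA, hB⟩ := hr
  have h := hp.1
  simp only [hB, IsPrimitiveForm] at h
  have : u.α ∣ (1 : ℕ) := by
    rw [← h]
    refine Int.dvd_coe_gcd ?_ (Int.dvd_coe_gcd ?_ ?_)
    · simp
    · simp
    · simpa using Dvd.dvd.mul_right (hA 1) _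
  exact Int.eq_one_of_dvd_one h0.le (by simpa using this)

theorem not_isDegenerate_ofDiag {u : M (Fin 3 → ℤ)} (hr : IsReducedDiag u)
    (hp : IsProjectiveDiag u) {p : ℕ} (hpp : p.Prime) :
    ¬ IsDegenerate (modulus p) (ofDiag u : M (H3 C)) := by
  rintro ⟨l, hl⟩
  have hα := alpha_eq_one hr hp
  have hB := hr.2.2.2
  obtain ⟨α, β, A, B⟩ := u
  simp only at hα hB
  subst hα hB
  have hu : (ofDiag ⟨1, β, A, 0⟩ : M (H3 C)) = ⟨1, β, diag (A 0) (A 1) (A 2), 0⟩ := by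
    ext1 <;> rfl
  rw [hu] at hl
  have key : ∀ y : M (H3 C), modulus p ∣
      y.α * (2 * N (diag (A 0) (A 1) (A 2) : H3 C) + β ^ 2 + 2 * l * β) + y.β * (β - 2 * l)
      + 2 * bil (sharp (diag (A 0) (A 1) (A 2))) y.A
      - (β + 2 * l) * bil (diag (A 0) (A 1) (A 2)) y.B := by
    intro y
    have h := hl y
    rw [linCoeff_eq] at h
    refine Int.dvd_of_mul_dvd_mul_left (by norm_num : (24 : ℤ) ≠ 0) ?_
    convert h using 1
    simp only [symp, zero_bil]
    ring
  -- Test vectors isolating `β - 2l`, twice each product of two entries, and the `α`-component. At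
  -- `p = 2` the modulus 4 is needed here: the factor 2 would make the conditions on the products
  -- empty modulo 2.
  have k1 := key ⟨0, 1, 0, 0⟩
  have k2 := key ⟨0, 0, diag 1 0 0, 0⟩
  have k3 := key ⟨0, 0, diag 0 1 0, 0⟩
  have k4 := key ⟨0, 0, diag 0 0 1, 0⟩
  have k5 := key ⟨1, 0, 0, 0⟩
  have hN : N (diag (A 0) (A 1) (A 2) : H3 C) = A 0 * A 1 * A 2 := by simp [N, diag]
  rw [hN] at k5
  simp [bil, sharp, diag] at k1 k2 k3 k4 k5
  have hP : Prime (p : ℤ) := Nat.prime_iff_prime_int.1 hpp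
  have hmain : (p : ℤ) ∣ β ∧ (p : ℤ) ∣ A 1 * A 2 ∧ (p : ℤ) ∣ A 0 * A 2 ∧ (p : ℤ) ∣ A 0 * A 1 := by
    unfold modulus at k1 k2 k3 k4 k5
    split_ifs at k1 k2 k3 k4 k5 with h2
    · subst h2
      refine ⟨?_, ?_, ?_, ?_⟩ <;> push_cast <;> omega
    · have hodd : ¬ (p : ℤ) ∣ 2 := by
        intro h
        have : p ∣ 2 := by exact_mod_cast h
        exact h2 ((Nat.prime_dvd_prime_iff_eq hpp Nat.prime_two).1 this)
      have c1 := (hP.dvd_or_dvd k2).resolve_left hodd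
      have c2 := (hP.dvd_or_dvd k3).resolve_left hodd
      have c3 := (hP.dvd_or_dvd k4).resolve_left hodd
      refine ⟨?_, c1, c2, c3⟩
      have e : 2 * (β * β) = (2 * (A 0 * A 1 * A 2) + β ^ 2 + 2 * l * β) + β * (β - 2 * l)
        - 2 * A 2 * (A 0 * A 1) := by ring
      have : (p : ℤ) ∣ 2 * (β * β) := by
        rw [e]
        exact dvd_sub (dvd_add k5 (Dvd.dvd.mul_left k1 _)) (Dvd.dvd.mul_left c3 _)
      have := (hP.dvd_or_dvd this).resolve_left hodd
      exact (hP.dvd_or_dvd this).elim id id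
  obtain ⟨hβ, h12, h02, h01⟩ := hmain
  have prim : ∀ {x y z : ℤ}, IsPrimitiveForm x y z → (p : ℤ) ∣ x → (p : ℤ) ∣ y → (p : ℤ) ∣ z →
      False := by
    intro x y z h hx hy hz
    have : (p : ℤ) ∣ ((Int.gcd x (Int.gcd y z) : ℕ) : ℤ) :=
      Int.dvd_coe_gcd hx (Int.dvd_coe_gcd hy hz)
    rw [show Int.gcd x (Int.gcd y z) = 1 from h] at this
    exact hpp.one_lt.ne' (by exact_mod_cast Int.eq_one_of_dvd_one (by positivity) this)
  obtain ⟨p1, p2, p3⟩ := hp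
  simp only [Pi.zero_apply, mul_zero, sub_zero, neg_zero, zero_add, one_mul,
    zero_sub] at p1 p2 p3
  -- If `p` divides `A i`, all coefficients `A i`, `-β` and minus the product of the other two
  -- entries of the `i`-th form are divisible by `p`.
  rcases hP.dvd_or_dvd h01 with h | h
  · exact prim p1 h ((dvd_neg).2 hβ) ((dvd_neg).2 h12)
  · exact prim p2 h ((dvd_neg).2 hβ) ((dvd_neg).2 (by rwa [mul_comm]))

/-- The property of `u` that replaces projectivity: `u` is degenerate at no prime. -/
def IsNondegenerate (u : M (H3 C)) : Prop := ∀ p : ℕ, p.Prime → ¬ IsDegenerate (modulus p) u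

theorem IsProjective.isNondegenerate {x : M (H3 C)} (hx : IsProjective x) : IsNondegenerate x := by
  obtain ⟨g, hg, u, hr, hp, hgx⟩ := hx
  intro p hpp hd
  refine not_isDegenerate_ofDiag (C := C) hr hp hpp ?_
  rw [← hgx]
  exact hg.isDegenerate hd

theorem ElementaryEquiv.isNondegenerate {u v : M (H3 C)} (h : ElementaryEquiv u v)
    (hu : IsNondegenerate u) : IsNondegenerate v :=
  fun p hp hd => hu p hp (h.isDegenerate hd)

/-! ### Reduction to `α = 1`, `B = 0` -/

theorem ElementaryEquiv.phi {u v : M (H3 C)} (h : ElementaryEquiv u v) (D : H3 C) :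
    ElementaryEquiv u (M.phi D v) := Relation.ReflTransGen.tail h (.phi D v)

theorem ElementaryEquiv.psi {u v : M (H3 C)} (h : ElementaryEquiv u v) (D : H3 C) :
    ElementaryEquiv u (M.psi D v) := Relation.ReflTransGen.tail h (.psi D v)

theorem ElementaryEquiv.tau {u v : M (H3 C)} (h : ElementaryEquiv u v) :
    ElementaryEquiv u (M.tau v) := Relation.ReflTransGen.tail h (.tau v)

/-- Since `τ² = -1`, otherwise `α = 0` throughout. Applying `φ(E)` for rank-one `E` then gives `B =
0`, and `τ` gives `β = 0` and `A = 0`; but the zero element is degenerate. -/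
theorem exists_pos_alpha {u : M (H3 C)} (hu : IsNondegenerate u) :
    ∃ v, ElementaryEquiv u v ∧ 0 < v.α := by
  by_contra! hneg
  have hα : ∀ v, ElementaryEquiv u v → v.α = 0 := by
    intro v hv
    have h1 := hneg v hv
    have h2 := hneg _ hv.tau.tau
    simp only [M.tau] at h2
    linarith
  have hB : ∀ v, ElementaryEquiv u v → v.B = 0 := by
    intro v hv
    obtain ⟨B, hB⟩ := exists_eq_zsmul_of_bil (d := 0) (A := v.B) fun E hE => by
      have h1 := hα _ (hv.phi E)
      have h2 := hα _ hv.tau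
      simp only [M.phi, M.tau, hE.1, hE.2.1, bil_zero, hα v hv] at h1 h2
      exact ⟨0, by linarith⟩
    rw [hB, zero_smul]
  have hr : ElementaryEquiv u u := Relation.ReflTransGen.refl
  have e1 := hα u hr
  have e2 : u.β = 0 := by
    have := hα _ hr.tau
    simp only [M.tau] at this
    linarith
  have e3 := hB u hr
  have e4 : u.A = 0 := hB _ hr.tau
  refine hu 2 Nat.prime_two ?_
  have := isDegenerate_of_dvd 2 0 0 (0 : H3 C)
  convert this using 1
  ext1 <;> simp [e1, e2, e3, e4]

theorem exists_min_alpha {u : M (H3 C)} (hu : IsNondegenerate u) :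
    ∃ v, ElementaryEquiv u v ∧ 0 < v.α ∧ ∀ w, ElementaryEquiv u w → 0 < w.α → v.α ≤ w.α := by
  classical
  have h : ∃ n : ℕ, ∃ v, ElementaryEquiv u v ∧ 0 < v.α ∧ v.α.toNat = n := by
    obtain ⟨v, hv, h0⟩ := exists_pos_alpha hu
    exact ⟨_, v, hv, h0, rfl⟩
  obtain ⟨v, hv, h0, hn⟩ := Nat.find_spec h
  refine ⟨v, hv, h0, fun w hw hw0 => ?_⟩
  have := Nat.find_min' h ⟨w, hw, hw0, rfl⟩
  omega

/-- Euclidean division on `r = (B, E)`: unimodularity of `E` lets `ψ` reduce `r` modulo `a`, and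
then `φ(-E)` replaces `α` by `a - r % a`. This lies in `(0, a]`, so minimality forces the remainder
to be 0. -/
theorem exists_B_eq_zsmul {u v : M (H3 C)} {a : ℤ} (ha : 0 < a)
    (hmin : ∀ w, ElementaryEquiv u w → 0 < w.α → a ≤ w.α) (hv : ElementaryEquiv u v)
    (hva : v.α = a) : ∃ B, v.B = a • B := by
  refine exists_eq_zsmul_of_bil fun E hE => ?_
  obtain ⟨h1, h2, D, hD⟩ := hE
  set r := bil v.B E with hr
  have hw := (hv.psi ((-(r / a)) • D)).phi (-E)
  have hwα : (M.phi (-E) (M.psi ((-(r / a)) • D) v)).α = a - r % a := by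
    simp only [M.phi, M.psi, sharp_neg, h1, N_neg, h2, bil_neg, bil_zero, add_bil, zsmul_bil, hD,
      hva, ← hr, Int.emod_def]
    ring
  have h0 := Int.emod_nonneg r ha.ne'
  have hlt := Int.emod_lt_of_pos r ha
  have := hmin _ hw (by rw [hwα]; linarith)
  rw [hwα] at this
  exact Int.dvd_of_emod_eq_zero (by linarith)

theorem exists_elementaryEquiv_B_eq_zero {u v : M (H3 C)} {a : ℤ} (ha : 0 < a)
    (hmin : ∀ w, ElementaryEquiv u w → 0 < w.α → a ≤ w.α) (hv : ElementaryEquiv u v)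
    (hva : v.α = a) :
    ∃ β K, ElementaryEquiv u ⟨a, β, v.A + a • K, 0⟩ := by
  obtain ⟨B, hB⟩ := exists_B_eq_zsmul ha hmin hv hva
  have h := hv.psi (-B)
  refine ⟨(M.psi (-B) v).β, -sharp B, ?_⟩
  convert h using 1
  ext1
  · exact hva.symm
  · rfl
  · simp only [M.psi, hB, hva, zsmul_cross, cross_neg, sharp_neg, H3.cross_self]
    module
  · simp only [M.psi, hB, hva, smul_neg, add_neg_cancel]

/-- For rank-one `E`, `φ(E)` keeps `α = a` and puts `A × E` into the `B`-slot, where divisibility is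
already known. -/
theorem exists_A_eq_zsmul {u : M (H3 C)} {a β : ℤ} {A : H3 C} (ha : 0 < a)
    (hmin : ∀ w, ElementaryEquiv u w → 0 < w.α → a ≤ w.α) (hv : ElementaryEquiv u ⟨a, β, A, 0⟩) :
    ∃ A', A = a • A' := by
  refine exists_eq_zsmul_of_cross fun E hE => ?_
  obtain ⟨A', hA⟩ := exists_B_eq_zsmul ha hmin (hv.phi E) (by
    simp [M.phi, hE.1, hE.2.1])
  exact ⟨A', by simpa [M.phi, hE.1] using hA⟩

theorem exists_elementaryEquiv_one {u : M (H3 C)} (hu : IsNondegenerate u) :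
    ∃ β A, ElementaryEquiv u ⟨1, β, A, 0⟩ := by
  obtain ⟨v, hv, ha, hmin⟩ := exists_min_alpha hu
  obtain ⟨β, K, hw⟩ := exists_elementaryEquiv_B_eq_zero ha hmin hv rfl
  generalize v.A + v.α • K = A at hw
  generalize v.α = a at *
  obtain ⟨A', rfl⟩ := exists_A_eq_zsmul ha hmin hw
  -- `φ(E)` with `E = diag(1, 0, 0)` moves `β` into `A`; clearing `B` alters `A` only by multiples
  -- of `a`.
  have hβ : a ∣ β := by
    obtain ⟨h1, h2, D, hD⟩ := isRankOne_a (C := C)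
    set E : H3 C := ⟨1, 0, 0, 0, 0, 0⟩
    obtain ⟨β', K', hw'⟩ := exists_elementaryEquiv_B_eq_zero ha hmin (hw.phi E) (by
      simp [M.phi, h1, h2])
    obtain ⟨L, hL⟩ := exists_A_eq_zsmul ha hmin hw'
    have h3 := congrArg (fun X => bil X D) hL
    simp only [M.phi, add_bil, zsmul_bil, bil_comm E, hD] at h3
    exact ⟨bil L D - bil A' D - bil K' D, by linarith⟩
  obtain ⟨β', rfl⟩ := hβ
  obtain rfl : a = 1 := by
    by_contra hne
    obtain ⟨p, hp, hpa⟩ := Nat.exists_prime_and_dvd (n := a.toNat) (by omega)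
    obtain ⟨k, hk⟩ : (p : ℤ) ∣ a := by
      have : (p : ℤ) ∣ (a.toNat : ℤ) := by exact_mod_cast hpa
      rwa [Int.toNat_of_nonneg ha.le] at this
    refine hw.isNondegenerate hu p hp ?_
    have := isDegenerate_of_dvd p k (k * β') (k • A')
    rwa [smul_smul, ← mul_assoc, ← hk] at this
  exact ⟨_, _, hw⟩

end M

/-! ### Diagonalization by norm-preserving maps. -/

section Hyperbolic

variable {C : Type} [AddCommGroup C] [CompositionOps C] [IsSplitComposition C]

theorem exists_isHyperbolic : ∃ e : C, IsHyperbolic e := by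
  by_contra! h
  obtain ⟨x, hx⟩ := exists_nrm (C := C) 1
  have : x = 0 := hyperbolic_induction (p := fun x => x = 0) (fun e he => absurd he (h e)) rfl
    (fun x y hx hy => by rw [hx, hy, add_zero]) (fun x hx => by rw [hx, neg_zero]) x
  rw [this, nrm_zero] at hx
  exact zero_ne_one hx

end Hyperbolic

namespace H3

variable {C : Type} [AddCommGroup C] [CompositionOps C] [IsSplitComposition C]

/-- The linear equivalence given by an additive map and its two-sided inverse. -/
def mkEquiv (f g : H3 C → H3 C) (hadd : ∀ A B, f (A + B) = f A + f B)
    (hl : ∀ A, g (f A) = A) (hr : ∀ A, f (g A) = A) : H3 C ≃ₗ[ℤ] H3 C :=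
  AddEquiv.toIntLinearEquiv ⟨⟨f, g, hl, hr⟩, hadd⟩

/-- `A` is carried to `A'` by a norm-preserving transformation that has an adjoint. -/
def NormEquiv (A A' : H3 C) : Prop :=
  ∃ s s' : H3 C ≃ₗ[ℤ] H3 C, IsNormPreserving s ∧ IsAdjoint s s' ∧ s A = A'

theorem NormEquiv.refl (A : H3 C) : NormEquiv A A :=
  ⟨LinearEquiv.refl ℤ _, LinearEquiv.refl ℤ _, fun _ => rfl, fun _ _ => rfl, rfl⟩

theorem NormEquiv.trans {A B D : H3 C} (h : NormEquiv A B) (h' : NormEquiv B D) :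
    NormEquiv A D := by
  obtain ⟨s, s', hs, hs', rfl⟩ := h
  obtain ⟨r, r', hr, hr', rfl⟩ := h'
  refine ⟨s.trans r, r'.trans s', fun A => ?_, fun A B => ?_, rfl⟩
  · exact (hr _).trans (hs A)
  · exact (hr' _ _).trans (hs' _ _)

theorem NormEquiv.exists_eq_zsmul {d : ℤ} {A B : H3 C} (h : NormEquiv (d • A) B) :
    ∃ B', B = d • B' := by
  obtain ⟨s, s', hs, hs', rfl⟩ := h
  exact ⟨s A, map_zsmul s d A⟩

theorem NormEquiv.exists_eq_zsmul_of_eq {d : ℤ} {A B B' : H3 C} (h : NormEquiv A B)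
    (hB : B = d • B') : ∃ A', A = d • A' := by
  obtain ⟨s, s', hs, hs', rfl⟩ := h
  refine ⟨s.symm B', ?_⟩
  rw [← map_zsmul, ← hB, LinearEquiv.symm_apply_apply]

theorem NormEquiv.exists_sharp_eq_zsmul {d : ℤ} {A B B' : H3 C} (h : NormEquiv A B)
    (hB : sharp B = d • B') : ∃ A', sharp A = d • A' := by
  obtain ⟨s, s', hs, hs', rfl⟩ := h
  rw [sharp_map hs hs', LinearEquiv.symm_apply_eq, map_zsmul] at hB
  exact ⟨_, hB⟩

/-! ### Generators of the norm-preserving group -/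

/-- Cyclic permutation of the indices. -/
def cyc (A : H3 C) : H3 C := ⟨A.b, A.c, A.a, A.y, A.z, A.x⟩

/-- Transposition of the first two indices. -/
def swap (A : H3 C) : H3 C := ⟨A.b, A.a, A.c, conj A.y, conj A.x, conj A.z⟩

/-- Adding a multiple of the first row and column to the second. -/
def shear (w : C) (A : H3 C) : H3 C :=
  ⟨A.a, A.b + trc (cmul A.z (conj w)) + A.a * nrm w, A.c, A.x + cmul (conj w) (conj A.y), A.y,
    A.z + A.a • w⟩

/-- Adding a multiple of the second row and column to the first. -/
def coshear (w : C) (A : H3 C) : H3 C :=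
  ⟨A.a + trc (cmul A.z (conj w)) + A.b * nrm w, A.b, A.c, A.x, A.y + cmul (conj A.x) (conj w),
    A.z + A.b • w⟩

theorem normEquiv_cyc (A : H3 C) : NormEquiv A (cyc A) := by
  refine ⟨mkEquiv cyc (fun A => cyc (cyc A)) (fun _ _ => rfl) (fun _ => rfl) (fun _ => rfl),
    mkEquiv (fun A => cyc (cyc A)) cyc (fun _ _ => rfl) (fun _ => rfl) (fun _ => rfl),
    fun A => ?_, fun A B => ?_, rfl⟩
  · change N (cyc A) = N A
    simp only [N, cyc, trc_cyc A.x]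
    ring
  · change bil (cyc A) B = bil A (cyc (cyc B))
    simp only [bil, cyc]
    ring

theorem trc_conj_cmul (x y : C) : trc (cmul (conj x) (conj y)) = trc (cmul x y) := by
  rw [← conj_cmul, trc_conj, trc_comm]

theorem normEquiv_swap (A : H3 C) : NormEquiv A (swap A) := by
  have hinv : ∀ A : H3 C, swap (swap A) = A := fun A => by ext1 <;> simp [swap]
  have hadd : ∀ A B : H3 C, swap (A + B) = swap A + swap B := fun A B => by
    ext1 <;> simp [swap, conj_add]
  refine ⟨mkEquiv swap swap hadd hinv hinv, mkEquiv swap swap hadd hinv hinv,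
    fun A => ?_, fun A B => ?_, rfl⟩
  · change N (swap A) = N A
    simp only [N, swap, nrm_conj]
    rw [trc_cyc, trc_cyc, trc_conj3, trc_cyc, trc_cyc, trc_cyc]
    ring
  · change bil (swap A) B = bil A (swap B)
    simp only [bil, swap, trc_conj_cmul, conj_conj]
    ring

theorem shear_add (w : C) (A B : H3 C) : shear w (A + B) = shear w A + shear w B := by
  ext1
  · rfl
  · simp only [shear, add_a, add_b, add_z, add_cmul, trc_add]; ring
  · rfl
  · simp only [shear, add_x, add_y, conj_add, cmul_add]; abel
  · rfl
  · simp only [shear, add_a, add_z]; module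

theorem coshear_add (w : C) (A B : H3 C) : coshear w (A + B) = coshear w A + coshear w B := by
  ext1
  · simp only [coshear, add_a, add_b, add_z, add_cmul, trc_add]; ring
  · rfl
  · rfl
  · rfl
  · simp only [coshear, add_x, add_y, conj_add, add_cmul]; abel
  · simp only [coshear, add_b, add_z]; module

theorem shear_neg_shear (w : C) (A : H3 C) : shear (-w) (shear w A) = A := by
  ext1
  · rfl
  · simp only [shear, conj_neg, cmul_neg, trc_neg, nrm_neg, add_cmul, trc_add, zsmul_cmul,
      trc_zsmul, trc_self]
    ring
  · rfl
  · simp only [shear, conj_neg, neg_cmul]; abel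
  · rfl
  · simp only [shear]; module

theorem coshear_neg_coshear (w : C) (A : H3 C) : coshear (-w) (coshear w A) = A := by
  ext1
  · simp only [coshear, conj_neg, cmul_neg, trc_neg, nrm_neg, add_cmul, trc_add, zsmul_cmul,
      trc_zsmul, trc_self]
    ring
  · rfl
  · rfl
  · rfl
  · simp only [coshear, conj_neg, cmul_neg]; abel
  · simp only [coshear]; module

/-- The shear by `w` as a linear equivalence. -/
def shearEquiv (w : C) : H3 C ≃ₗ[ℤ] H3 C :=
  mkEquiv (shear w) (shear (-w)) (shear_add w) (shear_neg_shear w)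
    (fun A => by simpa using shear_neg_shear (-w) A)

/-- The transposed shear by `w` as a linear equivalence. -/
def coshearEquiv (w : C) : H3 C ≃ₗ[ℤ] H3 C :=
  mkEquiv (coshear w) (coshear (-w)) (coshear_add w) (coshear_neg_coshear w)
    (fun A => by simpa using coshear_neg_coshear (-w) A)

/-- The adjoint of a shear for the trace form is the transposed shear. -/
theorem normEquiv_shear (w : C) (A : H3 C) : NormEquiv A (shear w A) := by
  refine ⟨shearEquiv w, coshearEquiv w, fun A => ?_, fun A B => ?_, rfl⟩
  · change N (shear w A) = N A
    have h1 : trc (cmul A.x (conj (cmul (conj w) (conj A.y)))) = trc (cmul (cmul A.x A.y) w) := by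
      rw [conj_cmul, conj_conj, conj_conj, trc_assoc]
    have h2 : trc (cmul w (conj w)) = 2 * nrm w := trc_self w
    have h3 : trc (cmul (conj w) A.z) = trc (cmul A.z (conj w)) := trc_comm _ _
    have h4 : trc (cmul (conj w) w) = 2 * nrm w := by rw [trc_comm, h2]
    simp only [N, shear, nrm_add, nrm_cmul, nrm_conj, nrm_zsmul, add_cmul, cmul_add,
      cmul_conj_cmul, conj_zsmul, cmul_zsmul, zsmul_cmul, trc_add, trc_zsmul, h1, h3, h4]
    ring
  · change bil (shear w A) B = bil A (coshear w B)
    have h1 : trc (cmul (cmul (conj w) (conj A.y)) (conj B.x)) =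
        trc (cmul A.y (cmul w B.x)) := by
      rw [trc_conj3, ← trc_assoc, trc_comm, ← trc_assoc]
    have h2 : trc (cmul w (conj B.z)) = trc (cmul B.z (conj w)) := trc_symm _ _
    simp only [bil, shear, coshear, add_cmul, conj_add, cmul_add, conj_cmul, conj_conj, conj_zsmul,
      cmul_zsmul, zsmul_cmul, trc_add, trc_zsmul, h1, h2]
    ring

theorem swap_shear_swap (w : C) (A : H3 C) : swap (shear (conj w) (swap A)) = coshear w A := by
  have h : trc (cmul (conj A.z) w) = trc (cmul A.z (conj w)) := by
    rw [← trc_conj_cmul, conj_conj]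
  ext1 <;> simp [swap, shear, coshear, conj_add, conj_zsmul, nrm_conj, conj_cmul, h]

theorem normEquiv_coshear (w : C) (A : H3 C) : NormEquiv A (coshear w A) := by
  rw [← swap_shear_swap]
  exact ((normEquiv_swap A).trans (normEquiv_shear _ _)).trans (normEquiv_swap _)

/-! ### Diagonalization -/

/-- A set of Hermitian matrices that is stable under row operations on the first two rows. -/
def IsShearStable (S : Set (H3 C)) : Prop :=
  ∀ A ∈ S, swap A ∈ S ∧ ∀ w, shear w A ∈ S ∧ coshear w A ∈ S

theorem exists_min_a (S : Set (H3 C)) : (∀ A ∈ S, A.a = 0) ∨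
    ∃ A ∈ S, A.a ≠ 0 ∧ ∀ B ∈ S, B.a ≠ 0 → A.a.natAbs ≤ B.a.natAbs := by
  classical
  by_cases h : ∃ n : ℕ, ∃ A ∈ S, A.a ≠ 0 ∧ A.a.natAbs = n
  · right
    obtain ⟨A, hA, h0, hn⟩ := Nat.find_spec h
    refine ⟨A, hA, h0, fun B hB hB0 => ?_⟩
    have := Nat.find_min' h ⟨B, hB, hB0, rfl⟩
    omega
  · left
    intro A hA
    by_contra h0
    exact h ⟨_, A, hA, h0, rfl⟩

section Stable

variable {S : Set (H3 C)} {A : H3 C} {a : ℤ}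

theorem IsShearStable.z_eq_zero (hS : IsShearStable S) (h0 : ∀ A ∈ S, A.a = 0) (hA : A ∈ S) :
    A.z = 0 := by
  obtain ⟨z, hz⟩ := exists_eq_zsmul_of_hyperbolic (d := 0) (x := A.z) fun e he => by
    have h := h0 _ ((hS A hA).2 e).2
    simp only [coshear, h0 A hA, he.1] at h
    exact ⟨0, by linarith⟩
  rw [hz, zero_smul]

/-- With `r` the pairing of `z` with `e`, a shear along the dual element `f` reduces `r` modulo `a`,
and a coshear along `±e` adds `±(r % a)` to the corner. A sign opposite to that of `a` contradicts
minimality unless the remainder is 0. -/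
theorem IsShearStable.exists_z_eq_zsmul (hS : IsShearStable S) (ha : a ≠ 0)
    (hmin : ∀ B ∈ S, B.a ≠ 0 → a.natAbs ≤ B.a.natAbs) (hA : A ∈ S) (hAa : A.a = a) :
    ∃ z, A.z = a • z := by
  refine exists_eq_zsmul_of_hyperbolic fun e he => ?_
  obtain ⟨h0, f, hf⟩ := he
  set r := trc (cmul A.z (conj e)) with hr
  have h1 := ((hS A hA).2 ((-(r / a)) • f)).1
  have hmem : ∀ σ : ℤ, ∃ B ∈ S, B.a = a + σ * (r % a) := by
    intro σ
    refine ⟨_, ((hS _ h1).2 (σ • e)).2, ?_⟩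
    simp only [shear, coshear, conj_zsmul, cmul_zsmul, add_cmul, zsmul_cmul, trc_add, trc_zsmul,
      nrm_zsmul, h0, hf, hAa, ← hr, Int.emod_def]
    ring
  have hnn := Int.emod_nonneg r ha
  have hlt := Int.emod_lt_abs r ha
  refine Int.dvd_of_emod_eq_zero ?_
  by_contra hne
  rcases lt_or_gt_of_ne ha with hneg | hpos
  · rw [abs_of_neg hneg] at hlt
    obtain ⟨B, hB, hBa⟩ := hmem 1
    have := hmin B hB (by omega)
    omega
  · rw [abs_of_pos hpos] at hlt
    obtain ⟨B, hB, hBa⟩ := hmem (-1)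
    have := hmin B hB (by omega)
    omega

/-- A coshear by a hyperbolic `e` keeps the corner and makes `z = b • e`; pairing with the dual of
`e` recovers `b`. -/
theorem IsShearStable.dvd_b (hS : IsShearStable S) (ha : a ≠ 0)
    (hmin : ∀ B ∈ S, B.a ≠ 0 → a.natAbs ≤ B.a.natAbs) (hA : A ∈ S) (hAa : A.a = a)
    (hz : A.z = 0) : a ∣ A.b := by
  obtain ⟨e, h0, f, hf⟩ := exists_isHyperbolic (C := C)
  obtain ⟨z, h⟩ := hS.exists_z_eq_zsmul ha hmin ((hS A hA).2 e).2 (by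
    simp [coshear, hAa, hz, h0])
  simp only [coshear, hz, zero_add] at h
  have h2 := congrArg (fun w => trc (cmul f (conj w))) h
  simp only [conj_zsmul, cmul_zsmul, trc_zsmul, hf, mul_one] at h2
  exact ⟨_, h2⟩

end Stable

theorem isShearStable_normEquiv (A : H3 C) : IsShearStable {B | NormEquiv A B} :=
  fun B hB => ⟨hB.trans (normEquiv_swap B), fun w =>
    ⟨hB.trans (normEquiv_shear w B), hB.trans (normEquiv_coshear w B)⟩⟩

theorem eq_zero_of_normEquiv_a_eq_zero {A : H3 C} (h0 : ∀ B, NormEquiv A B → B.a = 0) :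
    A = 0 := by
  have hz : ∀ B, NormEquiv A B → B.z = 0 := fun B hB =>
    (isShearStable_normEquiv A).z_eq_zero h0 hB
  have r := NormEquiv.refl A
  have r1 := r.trans (normEquiv_cyc A)
  have r2 := r1.trans (normEquiv_cyc _)
  ext1
  · exact h0 _ r
  · exact h0 _ r1
  · exact h0 _ r2
  · exact hz _ r1
  · exact hz _ r2
  · exact hz _ r

/-- Transposition of the last two indices. -/
theorem normEquiv_flip (A : H3 C) :
    NormEquiv A ⟨A.a, A.c, A.b, conj A.x, conj A.z, conj A.y⟩ :=
  (normEquiv_swap A).trans (normEquiv_cyc _)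

/-- A corner of least nonzero absolute value in the orbit clears its row and column, then divides
the remaining block. -/
theorem exists_normEquiv_block (A : H3 C) : ∃ (a : ℤ) (B : H3 C),
    NormEquiv A B ∧ B.a = a ∧ B.y = 0 ∧ B.z = 0 ∧ ∃ B', B = a • B' := by
  rcases exists_min_a {B | NormEquiv A B} with h0 | ⟨B, hB, ha, hmin⟩
  · obtain rfl := eq_zero_of_normEquiv_a_eq_zero h0
    exact ⟨0, 0, NormEquiv.refl 0, rfl, rfl, rfl, 0, (smul_zero _).symm⟩
  have hS := isShearStable_normEquiv A
  generalize hBa : B.a = a at ha hmin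
  have clear : ∀ B, NormEquiv A B → B.a = a →
      ∃ B', NormEquiv A B' ∧ B'.a = a ∧ B'.z = 0 ∧ B'.y = B.y := by
    intro B hB hBa
    obtain ⟨z, hz⟩ := hS.exists_z_eq_zsmul ha hmin hB hBa
    exact ⟨_, hB.trans (normEquiv_shear (-z) B), hBa, by simp [shear, hBa, hz], rfl⟩
  obtain ⟨B1, h1, h1a, h1z, -⟩ := clear B hB hBa
  obtain ⟨B2, h2, h2a, h2z, h2y⟩ := clear _ (h1.trans (normEquiv_flip B1)) h1a
  simp only [h1z, conj_zero] at h2y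
  have hb := hS.dvd_b ha hmin h2 h2a h2z
  have hc := hS.dvd_b ha hmin (h2.trans (normEquiv_flip B2)) h2a (by simp [h2y])
  -- A coshear by the conjugate of a null `w` puts this product into the `y`-slot, and the flip
  -- carries it to the `z`-slot. Taking `w` to be the right unit then gives `x`.
  have hx : ∀ w, ∃ w', cmul (conj B2.x) w = a • w' := by
    intro w
    induction w using hyperbolic_induction with
    | h e he =>
      have he' : nrm (conj e) = 0 := by rw [nrm_conj, he.1]
      obtain ⟨z, hz⟩ := hS.exists_z_eq_zsmul ha hmin
        ((h2.trans (normEquiv_coshear (conj e) B2)).trans (normEquiv_flip _))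
        (by simp [coshear, h2a, h2z, he'])
      simp only [coshear, h2y, zero_add, conj_conj] at hz
      exact ⟨conj z, by rw [← conj_zsmul, ← hz, conj_conj]⟩
    | h0 => exact ⟨0, by simp⟩
    | hadd x y hx hy =>
      obtain ⟨x', hx⟩ := hx
      obtain ⟨y', hy⟩ := hy
      exact ⟨x' + y', by rw [cmul_add, hx, hy, smul_add]⟩
    | hneg x hx =>
      obtain ⟨x', hx⟩ := hx
      exact ⟨-x', by rw [cmul_neg, hx, smul_neg]⟩
  obtain ⟨u, hu⟩ := exists_one (C := C)
  obtain ⟨x, hx⟩ := hx u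
  rw [hu] at hx
  have hx' : B2.x = a • conj x := by rw [← conj_zsmul, ← hx, conj_conj]
  obtain ⟨b, hb⟩ := hb
  obtain ⟨c, hc⟩ := hc
  refine ⟨a, B2, h2, h2a, h2y, h2z, ⟨1, b, c, conj x, 0, 0⟩, ?_⟩
  ext1
  · simpa using h2a
  · exact hb
  · exact hc
  · exact hx'
  · simpa using h2y
  · simpa using h2z

theorem exists_normEquiv_diag_of_block {A : H3 C} (hx : A.x = 0) (hy : A.y = 0) :
    ∃ a b, NormEquiv A (diag a b A.c) ∧ a ∣ b := by
  set S : Set (H3 C) := {B | NormEquiv A B ∧ B.x = 0 ∧ B.y = 0 ∧ B.c = A.c}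
  have hS : IsShearStable S := by
    rintro B ⟨hB, h1, h2, h3⟩
    refine ⟨⟨hB.trans (normEquiv_swap B), by simp [swap, h2], by simp [swap, h1], h3⟩,
      fun w => ⟨⟨hB.trans (normEquiv_shear w B), ?_, h2, h3⟩,
      ⟨hB.trans (normEquiv_coshear w B), h1, ?_, h3⟩⟩⟩
    · simp [shear, h1, h2]
    · simp [coshear, h1, h2]
  have hmem : A ∈ S := ⟨NormEquiv.refl A, hx, hy, rfl⟩
  rcases exists_min_a S with h0 | ⟨B, hB, ha, hmin⟩
  · refine ⟨0, 0, ?_, dvd_rfl⟩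
    convert NormEquiv.refl A using 1
    ext1
    · exact (h0 A hmem).symm
    · exact (h0 _ (hS A hmem).1).symm
    · rfl
    · exact hx.symm
    · exact hy.symm
    · exact (hS.z_eq_zero h0 hmem).symm
  · obtain ⟨z, hz⟩ := hS.exists_z_eq_zsmul ha hmin hB rfl
    have h1 := ((hS B hB).2 (-z)).1
    have hz1 : (shear (-z) B).z = 0 := by simp [shear, hz]
    have hb := hS.dvd_b ha hmin h1 rfl hz1
    refine ⟨_, _, ?_, hb⟩
    convert h1.1 using 1
    ext1
    · rfl
    · rfl
    · exact h1.2.2.2.symm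
    · exact h1.2.1.symm
    · exact h1.2.2.1.symm
    · exact hz1.symm

theorem exists_normEquiv_diag (A : H3 C) :
    ∃ a b c, NormEquiv A (diag a b c) ∧ a ∣ b ∧ b ∣ c := by
  obtain ⟨a, B, hB, ha, hy, hz, B', hB'⟩ := exists_normEquiv_block A
  obtain ⟨b, c, h, hbc⟩ := exists_normEquiv_diag_of_block (A := cyc B) hy hz
  have h1 : NormEquiv B (diag a b c) := by
    have := (((normEquiv_cyc B).trans h).trans (normEquiv_cyc _)).trans (normEquiv_cyc _)
    rw [← ha]
    exact this
  -- Divisibility of the whole matrix by `a` survives the linear map that diagonalizes the lower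
  -- block, hence `a ∣ b`.
  obtain ⟨D, hD⟩ := (hB' ▸ h1).exists_eq_zsmul
  exact ⟨a, b, c, hB.trans h1, ⟨D.b, congrArg H3.b hD⟩, hbc⟩

/-- A shear by `w` of norm `b - 1` turns the second entry into `b - nrm w = 1`; after a swap, this 1
clears the off-diagonal entry. -/
theorem normEquiv_diag_neg (b c : ℤ) : NormEquiv (diag (-1) b c : H3 C) (diag 1 (-b) c) := by
  obtain ⟨w, hw⟩ := exists_nrm (C := C) (b - 1)
  have h := (((normEquiv_shear w (diag (-1) b c)).trans (normEquiv_swap _)).trans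
    (normEquiv_shear (conj w) _))
  convert h using 1
  have h2 : trc (cmul (conj w) w) = 2 * nrm w := by rw [trc_comm, trc_self]
  ext1
  · simp [shear, swap, diag, hw]
  · simp [shear, swap, diag, hw, conj_neg, neg_cmul, trc_neg, nrm_conj, h2]
    ring
  all_goals simp [shear, swap, diag, hw, conj_neg]

theorem exists_normEquiv_diag_one {a b : ℤ} (c : ℤ) (ha : IsUnit a) (hb : IsUnit b) :
    ∃ k, NormEquiv (diag a b c : H3 C) (diag 1 1 k) := by
  have flip : ∀ a b c : ℤ, NormEquiv (diag a b c : H3 C) (diag a c b) := fun a b c => by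
    have := normEquiv_flip (diag a b c : H3 C)
    simpa [diag] using this
  have swp : ∀ a b c : ℤ, NormEquiv (diag a b c : H3 C) (diag b a c) := fun a b c => by
    have := normEquiv_swap (diag a b c : H3 C)
    simpa [diag, swap] using this
  have step : ∀ {a : ℤ} (b c : ℤ), IsUnit a → ∃ c', NormEquiv (diag a b c : H3 C) (diag 1 b c') := by
    intro a b c ha
    rcases Int.isUnit_iff.1 ha with rfl | rfl
    · exact ⟨c, NormEquiv.refl _⟩
    · exact ⟨-c, ((flip _ _ _).trans (normEquiv_diag_neg c b)).trans (flip _ _ _)⟩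
  obtain ⟨c1, h1⟩ := step b c ha
  obtain ⟨c2, h2⟩ := step 1 c1 hb
  exact ⟨c2, (h1.trans (swp _ _ _)).trans h2⟩

end H3

/-! ### Reduction to the normal form. -/

namespace M

open H3

variable {C : Type} [AddCommGroup C] [CompositionOps C] [IsSplitComposition C]

theorem ElementaryEquiv.tf {u : M (H3 C)} {α β : ℤ} {A A' : H3 C}
    (h : ElementaryEquiv u ⟨α, β, A, 0⟩) (hA : NormEquiv A A') :
    ElementaryEquiv u ⟨α, β, A', 0⟩ := by
  obtain ⟨s, s', hs, hs', rfl⟩ := hA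
  have h' : ElementaryEquiv u _ := Relation.ReflTransGen.tail h (.tf s s' hs hs' _)
  simpa [M.tf] using h'

/-- `φ(diag(0, 0, t))` feeds `βt` into `c` at the cost of `B = diag(bt, at, 0)`, which the `ψ` then
removes. -/
theorem ElementaryEquiv.move {u : M (H3 C)} {β a b c : ℤ}
    (h : ElementaryEquiv u ⟨1, β, diag a b c, 0⟩) (t : ℤ) :
    ElementaryEquiv u
      ⟨1, β - 2 * (a * b * t), diag a b (c + (β - a * b * t) * t), 0⟩ := by
  convert (h.phi (diag 0 0 t)).psi (diag (-(b * t)) (-(a * t)) 0) using 1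
  ext
  · simp [M.phi, M.psi, bil, sharp, diag, N]
  · simp [M.phi, M.psi, bil, sharp, cross_eq, diag, N]; ring
  all_goals simp [M.phi, M.psi, bil, N, sharp, cross_eq, diag]
  ring

theorem exists_prime_dvd_of_not_isUnit {a : ℤ} (ha : ¬ IsUnit a) :
    ∃ p : ℕ, p.Prime ∧ (p : ℤ) ∣ a := by
  obtain ⟨p, hp, h⟩ := Nat.exists_prime_and_dvd (n := a.natAbs)
    (fun h => ha (Int.isUnit_iff_natAbs_eq.2 h))
  exact ⟨p, hp, Int.natCast_dvd.2 h⟩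

/-- A prime dividing the new first entry divides the whole moved matrix, hence `a`, `b`, `c`, and
therefore `β`: degeneracy at that prime. -/
theorem exists_elementaryEquiv_isUnit {u : M (H3 C)} (hu : IsNondegenerate u) :
    ∃ β a b c, ElementaryEquiv u ⟨1, β, diag a b c, 0⟩ ∧ IsUnit a ∧ b ∣ c := by
  obtain ⟨β, A, hA⟩ := exists_elementaryEquiv_one hu
  obtain ⟨a, b, c, hd, hab, hbc⟩ := exists_normEquiv_diag A
  have h1 := hA.tf hd
  have h2 := h1.move 1
  obtain ⟨a', b', c', hd', hab', hbc'⟩ := exists_normEquiv_diag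
    (diag a b (c + (β - a * b * 1) * 1) : H3 C)
  refine ⟨_, a', b', c', h2.tf hd', ?_, hbc'⟩
  by_contra ha
  obtain ⟨p, hp, hpa⟩ := exists_prime_dvd_of_not_isUnit ha
  obtain ⟨k, hk⟩ := hpa
  obtain ⟨l, hl⟩ := hab'
  obtain ⟨m, hm⟩ := hbc'
  obtain ⟨D, hD⟩ := hd'.exists_eq_zsmul_of_eq (d := p) (B' := diag k (k * l) (k * l * m)) (by
    ext1 <;> simp [diag, hk, hl, hm, mul_assoc, -natCast_zsmul])
  have pa : (p : ℤ) ∣ a := ⟨_, congrArg H3.a hD⟩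
  have pc : (p : ℤ) ∣ c + (β - a * b * 1) * 1 := ⟨_, congrArg H3.c hD⟩
  have pab : (p : ℤ) ∣ a * b := Dvd.dvd.mul_right pa b
  have pb : (p : ℤ) ∣ b := pa.trans hab
  have pβ : (p : ℤ) ∣ β := by
    have e : β = (c + (β - a * b * 1) * 1) - c + a * b := by ring
    rw [e]
    exact dvd_add (dvd_sub pc (pb.trans hbc)) pab
  exact not_dvd_of_not_isDegenerate (h1.isNondegenerate hu p hp) pβ (Dvd.dvd.mul_right pb c)
    (Dvd.dvd.mul_right pa c) pab

theorem exists_elementaryEquiv_one_one {u : M (H3 C)} (hu : IsNondegenerate u) :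
    ∃ β k, ElementaryEquiv u ⟨1, β, diag 1 1 k, 0⟩ := by
  obtain ⟨β, a, b, c, h1, ha, hbc⟩ := exists_elementaryEquiv_isUnit hu
  have h2 := h1.move 1
  obtain ⟨a', b', c', hd, hab', hbc'⟩ := exists_normEquiv_diag
    (diag a b (c + (β - a * b * 1) * 1) : H3 C)
  have hunit : IsUnit (a' * b') := by
    by_contra hab
    obtain ⟨p, hp, hpab⟩ := exists_prime_dvd_of_not_isUnit hab
    have hP : Prime (p : ℤ) := Nat.prime_iff_prime_int.1 hp
    have hpa : ¬ (p : ℤ) ∣ a := fun h => hP.not_isUnit (isUnit_of_dvd_unit h ha)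
    obtain ⟨k, hk⟩ := hpab
    obtain ⟨m, hm⟩ := hbc'
    obtain ⟨l, hl⟩ := hab'
    -- The adjoint of `diag(a', b', c')` is divisible by `p` because `a' ∣ b' ∣ c'` makes `a'b'`
    -- divide the other two products. Since `a` is a unit, the adjoint before diagonalization yields
    -- `p ∣ b` and divisibility of the moved third entry.
    obtain ⟨D, hD⟩ := hd.exists_sharp_eq_zsmul (d := p) (B' := diag (k * (l * m)) (k * m) k) (by
      ext1 <;> simp [sharp, diag, hk, -natCast_zsmul]
      · rw [← mul_assoc, ← hk, hm, hl]; ring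
      · rw [← mul_assoc, ← hk, hm]; ring)
    have pb : (p : ℤ) ∣ b := by
      have : (p : ℤ) ∣ a * b := ⟨D.c, by simpa [sharp, diag, -natCast_zsmul] using congrArg H3.c hD⟩
      exact (hP.dvd_or_dvd this).resolve_left hpa
    have pc : (p : ℤ) ∣ c + (β - a * b * 1) * 1 := by
      have : (p : ℤ) ∣ a * (c + (β - a * b * 1) * 1) :=
        ⟨D.b, by simpa [sharp, diag, -natCast_zsmul] using congrArg H3.b hD⟩
      exact (hP.dvd_or_dvd this).resolve_left hpa
    have pab : (p : ℤ) ∣ a * b := Dvd.dvd.mul_left pb a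
    have pβ : (p : ℤ) ∣ β := by
      have e : β = (c + (β - a * b * 1) * 1) - c + a * b := by ring
      rw [e]
      exact dvd_add (dvd_sub pc (pb.trans hbc)) pab
    exact not_dvd_of_not_isDegenerate (h1.isNondegenerate hu p hp) pβ (Dvd.dvd.mul_right pb c)
      (Dvd.dvd.mul_left (pb.trans hbc) a) pab
  obtain ⟨k, hk⟩ := exists_normEquiv_diag_one (C := C) c' (isUnit_of_mul_isUnit_left hunit)
    (isUnit_of_mul_isUnit_right hunit)
  exact ⟨_, k, h2.tf (hd.trans hk)⟩

theorem q'_normalForm (ε k : ℤ) : q' (normalForm ε k : M (H3 C)) = 4 * k + ε ^ 2 := by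
  simp [q', normalForm, N, diag]

/-- Every projective element is carried to a normal form, determined by its quartic norm. -/
theorem IsProjective.exists_normalForm {x : M (H3 C)} (hx : IsProjective x) :
    ∃ ε k : ℤ, (ε = 0 ∨ ε = 1) ∧ x.ElementaryEquiv (normalForm ε k) ∧ x.q' = 4 * k + ε ^ 2 ∧
      (∀ ε' k' : ℤ, (ε' = 0 ∨ ε' = 1) →
        x.ElementaryEquiv (normalForm ε' k') → x.q' = 4 * k' + ε' ^ 2) ∧
      (∀ ε' k' : ℤ, (ε' = 0 ∨ ε' = 1) → x.q' = 4 * k' + ε' ^ 2 → ε' = ε ∧ k' = k) := by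
  obtain ⟨β, k, h⟩ := exists_elementaryEquiv_one_one hx.isNondegenerate
  -- With both unit entries equal to 1, a move by `t` changes `β` by `-2t`, leaving the remainder
  -- modulo 2.
  have h2 := h.move (β / 2)
  have e : β - 2 * (1 * 1 * (β / 2)) = β % 2 := by rw [Int.emod_def]; ring
  rw [e] at h2
  have hq : ∀ ε' k' : ℤ, x.ElementaryEquiv (normalForm ε' k') → x.q' = 4 * k' + ε' ^ 2 :=
    fun ε' k' h => by rw [h.q'_eq, q'_normalForm]
  have hq2 := hq _ _ h2
  have hε := Int.emod_two_eq_zero_or_one β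
  refine ⟨_, _, hε, h2, hq2, fun ε' k' _ => hq ε' k', fun ε' k' hε' hq' => ?_⟩
  rw [hq2] at hq'
  generalize k + (β - 1 * 1 * (β / 2)) * (β / 2) = K at *
  rcases hε with h0 | h0 <;> rcases hε' with h1 | h1 <;> rw [h0, h1] at hq' <;>
    rw [h0, h1] <;> omega

end M

end Freudenthal

theorem lemma4 :
    (∀ x : Freudenthal.M (Freudenthal.H3 Freudenthal.BinZ), x.IsProjective →
      ∃ ε k : ℤ, (ε = 0 ∨ ε = 1) ∧
        x.ElementaryEquiv (Freudenthal.M.normalForm ε k) ∧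
        x.q' = 4 * k + ε ^ 2 ∧
        (∀ ε' k' : ℤ, (ε' = 0 ∨ ε' = 1) →
          x.ElementaryEquiv (Freudenthal.M.normalForm ε' k') → x.q' = 4 * k' + ε' ^ 2) ∧
        (∀ ε' k' : ℤ, (ε' = 0 ∨ ε' = 1) → x.q' = 4 * k' + ε' ^ 2 → ε' = ε ∧ k' = k)) ∧
    (∀ x : Freudenthal.M (Freudenthal.H3 Freudenthal.QuatZ), x.IsProjective →
      ∃ ε k : ℤ, (ε = 0 ∨ ε = 1) ∧
        x.ElementaryEquiv (Freudenthal.M.normalForm ε k) ∧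
        x.q' = 4 * k + ε ^ 2 ∧
        (∀ ε' k' : ℤ, (ε' = 0 ∨ ε' = 1) →
          x.ElementaryEquiv (Freudenthal.M.normalForm ε' k') → x.q' = 4 * k' + ε' ^ 2) ∧
        (∀ ε' k' : ℤ, (ε' = 0 ∨ ε' = 1) → x.q' = 4 * k' + ε' ^ 2 → ε' = ε ∧ k' = k)) ∧
    (∀ x : Freudenthal.M (Freudenthal.H3 Freudenthal.OctZ), x.IsProjective →
      ∃ ε k : ℤ, (ε = 0 ∨ ε = 1) ∧
        x.ElementaryEquiv (Freudenthal.M.normalForm ε k) ∧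
        x.q' = 4 * k + ε ^ 2 ∧
        (∀ ε' k' : ℤ, (ε' = 0 ∨ ε' = 1) →
          x.ElementaryEquiv (Freudenthal.M.normalForm ε' k') → x.q' = 4 * k' + ε' ^ 2) ∧
        (∀ ε' k' : ℤ, (ε' = 0 ∨ ε' = 1) → x.q' = 4 * k' + ε' ^ 2 → ε' = ε ∧ k' = k)) := by
  exact ⟨fun _ hx => hx.exists_normalForm, fun _ hx => hx.exists_normalForm,
    fun _ hx => hx.exists_normalForm⟩
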